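/- Let $(\mathcal L,[\cdot_\lambda\cdot])$ be a Lie conformal algebra over $\mathbb C$ with a Nijenhuis operator, i.e. a $\mathbb C[\partial]$-linear map $\mathcal N:\mathcal L\to\mathcal L$ with $[\mathcal N(p)_\lambda\mathcal N(q)]=\mathcal N\big([p_\lambda q]_{\mathcal N}\big)$, where $[p_\lambda q]_{\mathcal N}=[\mathcal N(p)_\lambda q]+[p_\lambda\mathcal N(q)]-\mathcal N([p_\lambda q])$. Let $(\mathcal M,\rho,\mathcal N_{\mathcal M})$ be a Nijenhuis representation: $(\mathcal M,\rho)$ is a representation of $\mathcal L$ and $\mathcal N_{\mathcal M}:\mathcal M\to\mathcal M$ is $\mathbb C[\partial]$-linear with $$\rho(\mathcal N(p))_\lambda\mathcal N_{\mathcal M}(m)=\mathcal N_{\mathcal M}\Big(\rho(\mathcal N(p))_\lambda m+\rho(p)_\lambda\mathcal N_{\mathcal M}(m)-\mathcal N_{\mathcal M}(\rho(p)_\lambda m)\Big).$$ For $n\ge1$ let $C^n=C^n(\mathcal L,\mathcal M)$ be the space of $\mathbb C$-multilinear maps $f_{\lambda_1,\dots,\lambda_{n-1}}:\mathcal L^{n}\to\mathcal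 M[\lambda_1,\dots,\lambda_{n-1}]$ such that, with $\lambda_n:=-\partial-\lambda_1-\dots-\lambda_{n-1}$, one has $f(\dots,\partial p_i,\dots)=-\lambda_i f(\dots,p_i,\dots)$ for $1\le i\le n$, and $f$ is skew-symmetric under simultaneous permutations of the $p_i$ and the $\lambda_i$. Let $C^0=\mathcal M/\partial\mathcal M$. For a $\lambda$-bracket $b$ on $\mathcal L$, an action $B$ and $f\in C^n$, $n\ge1$, put $$D_{b,B}f(p_1,\dots,p_{n+1})=\sum_{i}(-1)^{i+1}B(p_i)_{\lambda_i}f_{\lambda_1,\dots,\widehat{\lambda_i},\dots,\lambda_n}(p_1,\dots,\widehat{p_i},\dots,p_{n+1})+\sum_{i<j}(-1)^{i+j}f_{\lambda_i+\lambda_j,\lambda_1,\dots,\widehat{\lambda_i},\dots,\widehat{\lambda_j},\dots,\lambda_n}(b(p_i,p_j)_{\lambda_i},p_1,\dots,\widehat{p_i},\dots,\widehat{p_j},\dots,p_{n+1}),$$ where $\lambda_{n+1}=-\partial-\lambda_1-\dots-\lambda_n$ and $f$ on $n$ arguments uses only the first $n-1$ of the parameters attached to them. Define $\delta=D_{[\cdot_\lambda\cdot],\rho}$,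 $d_{\mathcal N}=D_{[\cdot_\lambda\cdot]_{\mathcal N},\rho\circ\mathcal N}-\mathcal N_{\mathcal M}\circ\delta$, and on $C^0$ put $(\delta[m])(p)=\rho(p)_{-\partial}m$, $(d_{\mathcal N}[m])(p)=\rho(\mathcal N(p))_{-\partial}m-\mathcal N_{\mathcal M}(\rho(p)_{-\partial}m)$. Let $$(\xi^nf)(p_1,\dots,p_n)=\sum_{S\subseteq\{1,\dots,n\}}(-1)^{|S|}\mathcal N_{\mathcal M}^{|S|}f(q_1,\dots,q_n),\qquad q_i=p_i\ (i\in S),\quad q_i=\mathcal N(p_i)\ (i\notin S),$$ so that $\xi^0=\mathrm{id}$. Then: (1) The groups $C^1_{\mathcal NL}=C^1$ and $C^n_{\mathcal NL}=C^n\oplus C^{n-1}$ for $n\ge2$, with $d^1_{\mathcal NL}(f)=(\delta f,-\xi^1f)$ and $d^n_{\mathcal NL}(f,g)=(\delta f,(-1)^n\xi^nf+d_{\mathcal N}g)$ for $n\ge 2$, form a cochain complex: each $d^n_{\mathcal NL}$ is a well-defined linear map $C^n_{\mathcal NL}\to C^{n+1}_{\mathcal NL}$, and $d^{n+1}_{\mathcal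 NL}\circ d^n_{\mathcal NL}=0$ for all $n\ge1$. (2) The groups $C^0$ in degree $0$ and $C^n\oplus C^{n-1}$ in every degree $n\ge1$, with $c\mapsto(\delta c,\xi^0 c)$ in degree $0$ and $(f,g)\mapsto(\delta f,(-1)^n\xi^nf+d_{\mathcal N}g)$ in degree $n\ge1$, form a cochain complex in the same sense, with square zero for all $n\ge0$. In particular, both hold for the adjoint Nijenhuis representation $(\mathcal L,\mathrm{ad},\mathcal N)$, where $\mathrm{ad}(p)_\lambda q=[p_\lambda q]$. -/

import Mathlib

open scoped TensorProduct

namespace NijLCA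

universe u v

/-- The polynomial ring `ℂ[∂]`. -/
abbrev DRing : Type := Polynomial ℂ

/-- The polynomial ring `ℂ[∂][λ₁, …, λₖ]`. -/
abbrev LamRing (k : ℕ) : Type := MvPolynomial (Fin k) DRing

/-- For a `ℂ[∂]`-module `M`, the space `M[λ₁, …, λₖ]` of polynomials in `λ₁, …, λₖ` with
coefficients in `M`, as a module over `ℂ[∂][λ₁, …, λₖ]` (`∂` acts on the coefficients). -/
def LamPoly (k : ℕ) (M : Type v) [AddCommGroup M] [Module DRing M] : Type v :=
  LamRing k ⊗[DRing] M

section Instances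

variable {k : ℕ} {M : Type v} [AddCommGroup M] [Module DRing M]

noncomputable instance : AddCommGroup (LamPoly k M) :=
  inferInstanceAs (AddCommGroup (LamRing k ⊗[DRing] M))

noncomputable instance : Module (LamRing k) (LamPoly k M) :=
  inferInstanceAs (Module (LamRing k) (LamRing k ⊗[DRing] M))

noncomputable instance : Module DRing (LamPoly k M) :=
  inferInstanceAs (Module DRing (LamRing k ⊗[DRing] M))

noncomputable instance : Module ℂ (LamPoly k M) :=
  inferInstanceAs (Module ℂ (LamRing k ⊗[DRing] M))

instance : IsScalarTower DRing (LamRing k) (LamPoly k M) :=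
  inferInstanceAs (IsScalarTower DRing (LamRing k) (LamRing k ⊗[DRing] M))

instance : IsScalarTower ℂ (LamRing k) (LamPoly k M) :=
  inferInstanceAs (IsScalarTower ℂ (LamRing k) (LamRing k ⊗[DRing] M))

instance : IsScalarTower ℂ DRing (LamPoly k M) :=
  inferInstanceAs (IsScalarTower ℂ DRing (LamRing k ⊗[DRing] M))

end Instances

/-- `∂` as an element of `ℂ[∂][λ₁, …, λₖ]`. -/
noncomputable def del (k : ℕ) : LamRing k := MvPolynomial.C Polynomial.X

/-- The variable `λᵢ`. -/
noncomputable def lv {k : ℕ} (i : Fin k) : LamRing k := MvPolynomial.X i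

section Substitution

variable {A : Type u} [AddCommGroup A] [Module DRing A]
variable {M : Type v} [AddCommGroup M] [Module DRing M]

/-- The substitution `λᵢ ↦ μᵢ`, from `M[λ₁, …, λₖ]` to `M[λ₁, …, λₗ]`; the `μᵢ` may contain `∂`,
which acts on the coefficients. -/
noncomputable def subst {k l : ℕ} (μ : Fin k → LamRing l) :
    LamPoly k M →ₗ[DRing] LamPoly l M :=
  (LinearMap.rTensor M (MvPolynomial.aeval μ : LamRing k →ₐ[DRing] LamRing l).toLinearMap :
    LamRing k ⊗[DRing] M →ₗ[DRing] LamRing l ⊗[DRing] M)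

/-- The coefficients `mₐ ∈ M` of `∑ₐ λ₁^{a₁} ⋯ λₖ^{aₖ} mₐ`. -/
noncomputable def coeffs {k : ℕ} (v : LamPoly k M) : (Fin k →₀ ℕ) →₀ M :=
  TensorProduct.equivFinsuppOfBasisLeft (MvPolynomial.basisMonomials (Fin k) DRing) v

/-- `∑ₐ λ^a cₐ ↦ ∑ₐ μ^a F(cₐ)`: apply `F` to the coefficients and substitute `λᵢ ↦ μᵢ`. -/
noncomputable def evalWith {k l : ℕ} (μ : Fin k → LamRing l) (F : A → LamPoly l M)
    (v : LamPoly k A) : LamPoly l M :=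
  (coeffs v).sum fun a c => (∏ i, μ i ^ a i) • F c

theorem subst_smul {k l : ℕ} (μ : Fin k → LamRing l) (P : LamRing k) (v : LamPoly k M) :
    subst μ (P • v) = MvPolynomial.aeval μ P • subst μ v := by
  refine TensorProduct.induction_on (R := DRing) (M := LamRing k) (N := M)
    (motive := fun v => subst μ (P • (v : LamPoly k M)) =
      MvPolynomial.aeval μ P • subst μ (v : LamPoly k M)) v ?_ ?_ ?_
  · change subst μ (P • (0 : LamPoly k M)) = _ • subst μ (0 : LamPoly k M)
    rw [smul_zero, map_zero, smul_zero]
  · intro Q m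
    change (MvPolynomial.aeval μ (P * Q) : LamRing l) ⊗ₜ[DRing] m =
      (MvPolynomial.aeval μ P * MvPolynomial.aeval μ Q : LamRing l) ⊗ₜ[DRing] m
    rw [map_mul]
  · intro (x : LamPoly k M) (y : LamPoly k M) hx hy
    change subst μ (P • (x + y)) = _ • subst μ (x + y)
    rw [smul_add, map_add, map_add, smul_add]
    exact congrArg₂ (· + ·) hx hy

theorem subst_smul_complex {M : Type v} [AddCommGroup M] [Module DRing M]
    {k l : ℕ} (μ : Fin k → LamRing l) (c : ℂ) (v : LamPoly k M) :
    subst μ (c • v) = c • subst μ v := by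
  have h : ∀ (j : ℕ) (w : LamPoly j M), c • w = algebraMap ℂ (LamRing j) c • w :=
    fun j w => (algebraMap_smul (LamRing j) c w).symm
  rw [h, h, subst_smul]
  congr 1
  rw [IsScalarTower.algebraMap_apply ℂ DRing (LamRing k), AlgHom.commutes,
    ← IsScalarTower.algebraMap_apply]

end Substitution

section Algebra

variable {A : Type u} [AddCommGroup A] [Module DRing A]
variable {M : Type v} [AddCommGroup M] [Module DRing M]

/-- `B(p)_s v_{μ₁, …, μₖ}`, for a `λ`-action `B : A × M → M[λ]` and `v ∈ M[λ₁, …, λₖ]`: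
`B(p)_s` is applied to the coefficients of `v`. -/
noncomputable def opAct (B : A → M → LamPoly 1 M) {k l : ℕ} (p : A) (s : LamRing l)
    (μ : Fin k → LamRing l) (v : LamPoly k M) : LamPoly l M :=
  evalWith μ (fun m => subst ![s] (B p m)) v

/-- `B(w_s)_t m`, for a `λ`-action `B : A × M → M[λ]` and `w ∈ A[λ]`. -/
noncomputable def opComp (B : A → M → LamPoly 1 M) {l : ℕ} (w : LamPoly 1 A) (s t : LamRing l)
    (m : M) : LamPoly l M :=
  evalWith ![s] (fun c => subst ![t] (B c m)) w

end Algebra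

/-- Lie conformal algebras; `bracket p q` is `[p_λ q] ∈ L[λ]`. In the Jacobi identity
`λ = lv 0` and `μ = lv 1`. -/
class LieConformalAlgebra (L : Type u) [AddCommGroup L] [Module ℂ L] [Module DRing L]
    [IsScalarTower ℂ DRing L] where
  bracket : L →ₗ[ℂ] L →ₗ[ℂ] LamPoly 1 L
  del_left : ∀ p q : L, bracket ((Polynomial.X : DRing) • p) q = -((lv 0 : LamRing 1) • bracket p q)
  del_right : ∀ p q : L,
    bracket p ((Polynomial.X : DRing) • q) = (del 1 + lv 0) • bracket p q
  skew : ∀ p q : L, bracket p q = -subst ![-del 1 - lv 0] (bracket q p)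
  jacobi : ∀ p q r : L,
    opAct (fun a b => bracket a b) p (lv 0 : LamRing 2) ![lv 1] (bracket q r) =
      opComp (fun a b => bracket a b) (bracket p q) (lv 0 : LamRing 2) (lv 0 + lv 1) r +
        opAct (fun a b => bracket a b) q (lv 1 : LamRing 2) ![lv 0] (bracket p r)

/-- `[p_λ q]`. -/
noncomputable def br {L : Type u} [AddCommGroup L] [Module ℂ L] [Module DRing L]
    [IsScalarTower ℂ DRing L] [LieConformalAlgebra L] (p q : L) : LamPoly 1 L :=
  LieConformalAlgebra.bracket p q

/-- A representation of a Lie conformal algebra `L` on a `ℂ[∂]`-module `M`; `act p m` is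
`ρ(p)_λ m ∈ M[λ]`. -/
structure ConformalRep (L : Type u) [AddCommGroup L] [Module ℂ L] [Module DRing L]
    [IsScalarTower ℂ DRing L] [LieConformalAlgebra L]
    (M : Type v) [AddCommGroup M] [Module ℂ M] [Module DRing M] [IsScalarTower ℂ DRing M] where
  act : L →ₗ[ℂ] M →ₗ[ℂ] LamPoly 1 M
  del_left : ∀ (p : L) (m : M), act ((Polynomial.X : DRing) • p) m = -((lv 0 : LamRing 1) • act p m)
  del_right : ∀ (p : L) (m : M),
    act p ((Polynomial.X : DRing) • m) = (del 1 + lv 0) • act p m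
  comm : ∀ (p q : L) (m : M),
    opComp (fun a b => act a b) (br p q) (lv 0 : LamRing 2) (lv 0 + lv 1) m =
      opAct (fun a b => act a b) p (lv 0 : LamRing 2) ![lv 1] (act q m) -
        opAct (fun a b => act a b) q (lv 1 : LamRing 2) ![lv 0] (act p m)

section Main

variable {L : Type u} [AddCommGroup L] [Module ℂ L] [Module DRing L]
  [IsScalarTower ℂ DRing L]
variable {M : Type v} [AddCommGroup M] [Module ℂ M] [Module DRing M] [IsScalarTower ℂ DRing M]

/-- The adjoint representation `ad(p)_λ q = [p_λ q]`. -/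
noncomputable def adjoint (L : Type u) [AddCommGroup L] [Module ℂ L] [Module DRing L]
    [IsScalarTower ℂ DRing L] [LieConformalAlgebra L] : ConformalRep L L where
  act := LieConformalAlgebra.bracket
  del_left := LieConformalAlgebra.del_left
  del_right := LieConformalAlgebra.del_right
  comm p q r := by
    rw [LieConformalAlgebra.jacobi p q r, add_sub_cancel_right]; rfl

/-- The coefficientwise extension of a `ℂ[∂]`-linear map to `M[λ₁, …, λₖ]`. -/
noncomputable def ext (k : ℕ) (T : M →ₗ[DRing] M) : LamPoly k M →ₗ[DRing] LamPoly k M :=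
  (LinearMap.lTensor (LamRing k) T : LamRing k ⊗[DRing] M →ₗ[DRing] LamRing k ⊗[DRing] M)

/-- `N` is a Nijenhuis operator on the Lie conformal algebra `L`. -/
def IsNijenhuis [LieConformalAlgebra L] (N : L →ₗ[DRing] L) : Prop :=
  ∀ p q : L, br (N p) (N q) = ext 1 N (br (N p) q + br p (N q) - ext 1 N (br p q))

/-- `(M, ρ, N_M)` is a Nijenhuis representation of `(L, N)`. -/
def IsNijenhuisRep [LieConformalAlgebra L] (N : L →ₗ[DRing] L) (ρ : ConformalRep L M)
    (NM : M →ₗ[DRing] M) : Prop :=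
  ∀ (p : L) (m : M), ρ.act (N p) (NM m) =
    ext 1 NM (ρ.act (N p) m + ρ.act p (NM m) - ext 1 NM (ρ.act p m))

/-- The deformed bracket `[p_λ q]_N = [N(p)_λ q] + [p_λ N(q)] - N([p_λ q])`. -/
noncomputable def brN [LieConformalAlgebra L] (N : L →ₗ[DRing] L) (p q : L) : LamPoly 1 L :=
  br (N p) q + br p (N q) - ext 1 N (br p q)

/-- The subspace `∂M` of `M`. -/
noncomputable def delRange (M : Type v) [AddCommGroup M] [Module ℂ M] [Module DRing M]
    [IsScalarTower ℂ DRing M] : Submodule ℂ M :=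
  LinearMap.range ((LinearMap.lsmul DRing M Polynomial.X).restrictScalars ℂ)

/-- Where `n`-cochains take their values: `M / ∂M` for `n = 0`, and `M[λ₁, …, λₙ₋₁]` for
`n ≥ 1`. -/
def CochVal (M : Type v) [AddCommGroup M] [Module ℂ M] [Module DRing M]
    [IsScalarTower ℂ DRing M] : ℕ → Type v
  | 0 => M ⧸ delRange M
  | k + 1 => LamPoly k M

noncomputable instance : ∀ n, AddCommGroup (CochVal M n)
  | 0 => inferInstanceAs (AddCommGroup (M ⧸ delRange M))
  | k + 1 => inferInstanceAs (AddCommGroup (LamPoly k M))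

noncomputable instance : ∀ n, Module ℂ (CochVal M n)
  | 0 => inferInstanceAs (Module ℂ (M ⧸ delRange M))
  | k + 1 => inferInstanceAs (Module ℂ (LamPoly k M))

/-- All functions of `n` arguments in `L` with values in the value space of `n`-cochains. -/
abbrev RawCochain (L : Type u) (M : Type v) [AddCommGroup M] [Module ℂ M] [Module DRing M]
    [IsScalarTower ℂ DRing M] (n : ℕ) : Type (max u v) :=
  (Fin n → L) → CochVal M n

/-- The sequence `λ₁, …, λₖ, λₖ₊₁` in `ℂ[∂][λ₁, …, λₖ]`, where the last entry stands for
`-∂ - λ₁ - ⋯ - λₖ`. -/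
noncomputable def lam (k : ℕ) : Fin (k + 1) → LamRing k :=
  Fin.snoc (fun i => lv i) (-del k - ∑ i, lv i)

/-- `f_{μ₁, …, μₖ}(p₁, …, pₖ₊₁)`, for a sequence `μ₁, …, μₖ₊₁` whose last entry is not used. -/
noncomputable def evalAt {k l : ℕ} (f : (Fin (k + 1) → L) → LamPoly k M)
    (μ : Fin (k + 1) → LamRing l) (p : Fin (k + 1) → L) : LamPoly l M :=
  subst (fun a : Fin k => μ a.castSucc) (f p)

/-- `ℂ`-multilinearity, conformal sesquilinearity (`f(…, ∂pᵢ, …) = -λᵢ f(…, pᵢ, …)`, which for the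
last argument reads `f(…, ∂pₙ) = (∂ + λ₁ + ⋯ + λₙ₋₁) f(…, pₙ)`) and conformal skew-symmetry
(invariance up to sign under simultaneous permutation of the `pᵢ` and the `λᵢ`, with
`λₙ = -∂ - λ₁ - ⋯ - λₙ₋₁`). -/
structure IsCochain {k : ℕ} (f : (Fin (k + 1) → L) → LamPoly k M) : Prop where
  map_add : ∀ (p : Fin (k + 1) → L) (i : Fin (k + 1)) (x y : L),
    f (Function.update p i (x + y)) = f (Function.update p i x) + f (Function.update p i y)
  map_smul : ∀ (p : Fin (k + 1) → L) (i : Fin (k + 1)) (c : ℂ) (x : L),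
    f (Function.update p i (c • x)) = c • f (Function.update p i x)
  sesq : ∀ (p : Fin (k + 1) → L) (i : Fin (k + 1)),
    f (Function.update p i ((Polynomial.X : DRing) • p i)) = -(lam k i • f p)
  skew : ∀ (τ : Equiv.Perm (Fin (k + 1))) (p : Fin (k + 1) → L),
    evalAt f (lam k ∘ τ) (p ∘ τ) = ((Equiv.Perm.sign τ : ℤˣ) : ℤ) • f p

/-- The space `Cⁿ(L, M)` of `n`-cochains. -/
noncomputable def cochains (L : Type u) [AddCommGroup L] [Module ℂ L] [Module DRing L]
    (M : Type v) [AddCommGroup M] [Module ℂ M] [Module DRing M] [IsScalarTower ℂ DRing M] :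
    ∀ n, Submodule ℂ (RawCochain L M n)
  | 0 => ⊤
  | k + 1 =>
    let C : Submodule ℂ ((Fin (k + 1) → L) → LamPoly k M) :=
      { carrier := {f | IsCochain f}
        zero_mem' := by
          constructor <;> intros <;> simp [evalAt]
        add_mem' := by
          intro f g hf hg
          constructor
          · intro p i x y
            simp only [Pi.add_apply, hf.map_add, hg.map_add]; abel
          · intro p i c x
            simp only [Pi.add_apply, hf.map_smul, hg.map_smul, smul_add]
          · intro p i
            simp only [Pi.add_apply, hf.sesq, hg.sesq, smul_add, neg_add]
          · intro τ p
            have h1 := hf.skew τ p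
            have h2 := hg.skew τ p
            simp only [evalAt] at h1 h2
            simp only [evalAt, Pi.add_apply, map_add, smul_add, h1, h2]
        smul_mem' := by
          intro c f hf
          constructor
          · intro p i x y
            simp only [Pi.smul_apply, hf.map_add, smul_add]
          · intro p i d x
            simp only [Pi.smul_apply, hf.map_smul, smul_comm c d]
          · intro p i
            simp only [Pi.smul_apply, hf.sesq, smul_neg, smul_comm c (lam k i)]
          · intro τ p
            have h1 := hf.skew τ p
            simp only [evalAt] at h1
            simp only [evalAt, Pi.smul_apply, subst_smul_complex, h1]
            rw [smul_comm] }
    C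

section Operators

variable [LieConformalAlgebra L]

/-- `[m] ↦ ρ(p)_{-∂} m`, from `M / ∂M` to `M`. -/
noncomputable def actZero (ρ : ConformalRep L M) (p : L) :
    (M ⧸ delRange M) →ₗ[ℂ] LamPoly 0 M :=
  (delRange M).liftQ
    { toFun := fun m => subst ![-del 0] (ρ.act p m)
      map_add' := fun m m' => by rw [map_add, map_add]
      map_smul' := fun c m => by rw [map_smul, subst_smul_complex]; rfl }
    (by
      rintro _ ⟨m, rfl⟩
      change subst ![-del 0] (ρ.act p ((Polynomial.X : DRing) • m)) = 0
      rw [ρ.del_right, subst_smul]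
      simp [del, lv])

/-- The Chevalley–Eilenberg type expression, for a bracket `b : L × L → L[λ]`, a `λ`-action
`B : L × M → M[λ]`, and `n = k + 1`:
`∑ᵢ (-1)^{i+1} B(pᵢ)_{λᵢ} f_{λ₁, …, λ̂ᵢ, …, λₙ}(p₁, …, p̂ᵢ, …, pₙ₊₁)
 + ∑_{i<j} (-1)^{i+j} f_{λᵢ+λⱼ, λ₁, …, λ̂ᵢ, …, λ̂ⱼ, …, λₙ}(b(pᵢ, pⱼ)_{λᵢ}, p₁, …, p̂ᵢ, …, p̂ⱼ, …, pₙ₊₁)`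
with `λₙ₊₁ = -∂ - λ₁ - ⋯ - λₙ`. Indices start at `0` here; in the second sum a pair `i < j` is
given by `j : Fin (k + 2)` and `i : Fin (k + 1)` with `i.castSucc < j`, and then
`fun a => j.succAbove (i.succAbove a)` lists the remaining indices in increasing order. -/
noncomputable def ceSum (b : L → L → LamPoly 1 L) (B : L → M → LamPoly 1 M) {k : ℕ}
    (f : (Fin (k + 1) → L) → LamPoly k M) (p : Fin (k + 2) → L) : LamPoly (k + 1) M :=
  (∑ i : Fin (k + 2), (-1 : ℤ) ^ (i : ℕ) •
      opAct B (p i) (lam (k + 1) i) (fun a : Fin k => lam (k + 1) (i.succAbove a.castSucc))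
        (f fun a => p (i.succAbove a))) +
    ∑ j : Fin (k + 2), ∑ i : Fin (k + 1),
      if i.castSucc < j then
        (-1 : ℤ) ^ ((i : ℕ) + (j : ℕ)) •
          evalWith ![lam (k + 1) i.castSucc]
            (fun c => evalAt f
              (Fin.cons (lam (k + 1) i.castSucc + lam (k + 1) j)
                fun a => lam (k + 1) (j.succAbove (i.succAbove a)))
              (Fin.cons c fun a => p (j.succAbove (i.succAbove a))))
            (b (p i.castSucc) (p j))
      else 0

/-- The coboundary `δ` of the Lie conformal algebra `L` with coefficients in `(M, ρ)`; on
`0`-cochains `(δ[m])(p) = ρ(p)_{-∂} m`. -/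
noncomputable def rawDelta (ρ : ConformalRep L M) :
    ∀ n, RawCochain L M n → RawCochain L M (n + 1)
  | 0, f => fun p => actZero ρ (p 0) (f Fin.elim0)
  | k + 1, f => ceSum (k := k) br (fun p m => ρ.act p m) f

/-- The coboundary `d_{N, M}` of the Nijenhuis operator; on `0`-cochains
`(d[m])(p) = ρ(N p)_{-∂} m - N_M(ρ(p)_{-∂} m)`. -/
noncomputable def rawDN (N : L →ₗ[DRing] L) (ρ : ConformalRep L M) (NM : M →ₗ[DRing] M) :
    ∀ n, RawCochain L M n → RawCochain L M (n + 1)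
  | 0, f => fun p =>
      (actZero ρ (N (p 0)) (f Fin.elim0) - ext 0 NM (actZero ρ (p 0) (f Fin.elim0)) : LamPoly 0 M)
  | k + 1, f => fun p =>
      (ceSum (k := k) (brN N) (fun q m => ρ.act (N q) m) f p -
        ext (k + 1) NM (ceSum (k := k) br (fun q m => ρ.act q m) f p) : LamPoly (k + 1) M)

/-- The map `ξⁿ`:
`(ξⁿ f)(p₁, …, pₙ) = ∑_{S ⊆ {1, …, n}} (-1)^{|S|} N_M^{|S|}(f(q₁, …, qₙ))`, where `qᵢ = pᵢ` for
`i ∈ S` and `qᵢ = N(pᵢ)` for `i ∉ S`. -/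
noncomputable def rawXi (N : L →ₗ[DRing] L) (NM : M →ₗ[DRing] M) :
    ∀ n, RawCochain L M n → RawCochain L M n
  | 0, f => f
  | k + 1, f => fun p =>
      (∑ S : Finset (Fin (k + 1)), (-1 : ℤ) ^ S.card •
        ext k (NM ^ S.card) (f fun i => if i ∈ S then p i else N (p i)) : LamPoly k M)

/-- The map `d_{NL}`: `(f, g) ↦ (δⁿ f, (-1)ⁿ ξⁿ f + d_N^{n-1} g)`; for `n = 0` there is no
component `g`, and `f ↦ (δ⁰ f, ξ⁰ f)`. -/
noncomputable def rawDNL (N : L →ₗ[DRing] L) (ρ : ConformalRep L M) (NM : M →ₗ[DRing] M) :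
    ∀ n, RawCochain L M n × RawCochain L M (n - 1) → RawCochain L M (n + 1) × RawCochain L M n
  | 0, x => (rawDelta ρ 0 x.1, rawXi N NM 0 x.1)
  | n + 1, x => (rawDelta ρ (n + 1) x.1,
      (-1 : ℤ) ^ (n + 1) • rawXi N NM (n + 1) x.1 + rawDN N ρ NM n x.2)

end Operators

/-- The combined cochain groups in degrees `≥ 1`; the degree is `n + 1`. They are
`C¹(L, M)` in degree `1` and `Cⁿ(L, M) ⊕ C_N^{n-1}(L, M)` in degree `n ≥ 2`. -/
noncomputable def nlCochains (L : Type u) [AddCommGroup L] [Module ℂ L] [Module DRing L]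
    (M : Type v) [AddCommGroup M] [Module ℂ M] [Module DRing M] [IsScalarTower ℂ DRing M] :
    ∀ n, Submodule ℂ (RawCochain L M (n + 1) × RawCochain L M n)
  | 0 => (cochains L M 1).prod ⊥
  | n + 1 => (cochains L M (n + 2)).prod (cochains L M (n + 1))

/-- The combined cochain groups with degree `0` included: `C⁰(L, M)` in degree `0` and
`Cⁿ(L, M) ⊕ C_N^{n-1}(L, M)` in every degree `n ≥ 1`, where `C_N⁰ = C⁰`. -/
noncomputable def nlCochainsFull (L : Type u) [AddCommGroup L] [Module ℂ L] [Module DRing L]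
    (M : Type v) [AddCommGroup M] [Module ℂ M] [Module DRing M] [IsScalarTower ℂ DRing M] :
    ∀ n, Submodule ℂ (RawCochain L M n × RawCochain L M (n - 1))
  | 0 => (cochains L M 0).prod ⊥
  | n + 1 => (cochains L M (n + 1)).prod (cochains L M n)

end Main

/-- The maps `D n` restrict to `ℂ`-linear maps `G n → G (n + 1)` between the given subspaces, and
these form a cochain complex. -/
def FormsCochainComplex {A : ℕ → Type v} [∀ n, AddCommGroup (A n)] [∀ n, Module ℂ (A n)]
    (G : ∀ n, Submodule ℂ (A n)) (D : ∀ n, A n → A (n + 1)) : Prop :=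
  ∃ d : ∀ n, G n →ₗ[ℂ] G (n + 1),
    (∀ (n : ℕ) (x : G n), (d n x : A (n + 1)) = D n x) ∧
      ∀ n : ℕ, d (n + 1) ∘ₗ d n = 0

end NijLCA

/-! The conformal statement is reduced to one about an ordinary Lie algebra over a commutative ring.
For a commutative ℂ-algebra `R`, let `Cur R L` be the direct sum over `z : R` of the base changes of
`L` along `∂ ↦ -z`. Evaluating `[p_λ q]` at `λ = s` sends the summands with indices `s` and `t` to
the one with index `s + t`. Sesquilinearity makes this well defined, and conformal skew-symmetry and
the Jacobi identity become the usual axioms, so `Cur R L` is a Lie algebra with representation `Cur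
R M` (`exists_induces`, `Induces.isLieRep`). A cochain `f` becomes an alternating `R`-multilinear
map whose value on elements of indices `s₁, …, sₙ` is `f` evaluated at `λᵢ = sᵢ`, in the summand of
index `∑ sᵢ` (`exists_extends`). The dependent parameter `λₙ = -∂ - λ₁ - ⋯ - λₙ₋₁` thereby takes the
value `sₙ`, on the same footing as the others.

Nothing is lost: for `R = ℂ[∂][λ₁, …, λₖ]` and `sᵢ = λᵢ` the summand of index `-∂` is `M[λ₁, …, λₖ]`
itself (`ev_id_injective`). So identities, and membership in the cochain spaces, can be checked
after extension (`Extends.eq`, `Extends.isCochain`), and the conformal operators extend to the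
classical ones (`Extends.rawDelta`, `Extends.rawDN`, `Extends.rawXi`).

For ordinary Lie algebras everything follows from Cartan's formula `ι_x d + d ι_x = L_x` by
induction on the degree. Besides `d² = 0` one needs `d_N² = 0` (`dNij_dNij`), which comes from
compatibility of the original and the deformed brackets, and `ξ d = d_N ξ` (`xi_ce`). The combined
complex is then the mapping cone of the cochain map `ξ`. -/

namespace NijLCA

universe u v

set_option linter.unusedSectionVars false

/-! ### Cartan calculus for alternating forms -/

section CartanCalculus

variable {R V W : Type*} [CommRing R] [AddCommGroup V] [Module R V] [AddCommGroup W] [Module R W]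

/-- Functions of `n` variables in `V` with values in `W`. -/
abbrev Form (V W : Type*) (n : ℕ) : Type _ := (Fin n → V) → W

/-- Insertion of `x` as the first argument. -/
def ins {n : ℕ} (x : V) (F : Form V W (n + 1)) : Form V W n := fun w => F (Fin.cons x w)

theorem ins_add {n : ℕ} (x : V) (F G : Form V W (n + 1)) : ins x (F + G) = ins x F + ins x G := rfl

theorem ins_sub {n : ℕ} (x : V) (F G : Form V W (n + 1)) : ins x (F - G) = ins x F - ins x G := rfl

/-- The induction principle behind all identities between forms below: compare insertions, which
have one argument fewer. -/
theorem form_ext {n : ℕ} {F G : Form V W (n + 1)} (h : ∀ x, ins x F = ins x G) : F = G := by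
  funext v
  have := congrFun (h (v 0)) (Fin.tail v)
  simpa [ins] using this

/-- Postcomposition with a linear map. -/
def post (T : W →ₗ[R] W) {n : ℕ} : Form V W n →ₗ[R] Form V W n := T.compLeft (Fin n → V)

@[simp] theorem post_apply (T : W →ₗ[R] W) {n : ℕ} (F : Form V W n) (v : Fin n → V) :
    post T F v = T (F v) := rfl

theorem ins_post (T : W →ₗ[R] W) {n : ℕ} (x : V) (F : Form V W (n + 1)) :
    ins x (post T F) = post T (ins x F) := rfl

/-- The sum over all arguments of the functions obtained by applying `T` to that argument. -/
def der (T : V →ₗ[R] V) {n : ℕ} : Form V W n →ₗ[R] Form V W n where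
  toFun F := fun w => ∑ j, F (Function.update w j (T (w j)))
  map_add' F G := by funext w; simp [Finset.sum_add_distrib]
  map_smul' c F := by funext w; simp [Finset.smul_sum]

theorem der_apply (T : V →ₗ[R] V) {n : ℕ} (F : Form V W n) (w : Fin n → V) :
    der T F w = ∑ j, F (Function.update w j (T (w j))) := rfl

theorem ins_der (T : V →ₗ[R] V) {n : ℕ} (y : V) (F : Form V W (n + 1)) :
    ins y (der T F) = der T (ins y F) + ins (T y) F := by
  funext w
  simp only [ins, der_apply, Pi.add_apply, Fin.sum_univ_succ, Fin.cons_zero, Fin.cons_succ,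
    Fin.update_cons_zero, Fin.cons_update]
  rw [add_comm]

theorem der_post (T : V →ₗ[R] V) (S : W →ₗ[R] W) {n : ℕ} (F : Form V W n) :
    der T (post S F) = post S (der T F) := by
  funext w; simp [der_apply]

/-- The Lie derivative along `x`, for a bracket `b` and an action `B`. -/
def lieD (b : V →ₗ[R] V →ₗ[R] V) (B : V →ₗ[R] W →ₗ[R] W) (x : V) {n : ℕ} :
    Form V W n →ₗ[R] Form V W n := post (B x) - der (b x)

theorem lieD_apply (b : V →ₗ[R] V →ₗ[R] V) (B : V →ₗ[R] W →ₗ[R] W) (x : V) {n : ℕ}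
    (F : Form V W n) : lieD b B x F = post (B x) F - der (b x) F := rfl

theorem lieD_zero_apply (b : V →ₗ[R] V →ₗ[R] V) (B : V →ₗ[R] W →ₗ[R] W) (x : V)
    (F : Form V W 0) (v : Fin 0 → V) : lieD b B x F v = B x (F v) := by
  simp [lieD_apply, der_apply]

theorem ins_lieD (b : V →ₗ[R] V →ₗ[R] V) (B : V →ₗ[R] W →ₗ[R] W) (x y : V) {n : ℕ}
    (F : Form V W (n + 1)) :
    ins y (lieD b B x F) = lieD b B x (ins y F) - ins (b x y) F := by
  rw [lieD_apply, ins_sub, ins_post, ins_der, lieD_apply]; abel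

/-- The Chevalley–Eilenberg differential, for a bracket `b` and an action `B`. -/
def ce (b : V →ₗ[R] V →ₗ[R] V) (B : V →ₗ[R] W →ₗ[R] W) {n : ℕ} :
    Form V W n →ₗ[R] Form V W (n + 1) where
  toFun F := fun v => ∑ j : Fin (n + 1), (-1 : ℤ) ^ (j : ℕ) • (B (v j) (F (j.removeNth v)) +
    ∑ i : Fin n, if i.castSucc < j then
      F (Function.update (j.removeNth v) i (b (v i.castSucc) (v j))) else 0)
  map_add' F G := by
    funext v
    simp only [Pi.add_apply, map_add, ← Finset.sum_add_distrib]
    refine Finset.sum_congr rfl fun j _ => ?_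
    rw [← smul_add, add_add_add_comm, ← Finset.sum_add_distrib]
    congr 2
    refine Finset.sum_congr rfl fun i _ => ?_
    split_ifs <;> simp
  map_smul' c F := by
    funext v
    simp only [Pi.smul_apply, map_smul, RingHom.id_apply, Finset.smul_sum]
    refine Finset.sum_congr rfl fun j _ => ?_
    rw [smul_comm c, smul_add c, Finset.smul_sum]
    congr 2
    refine Finset.sum_congr rfl fun i _ => ?_
    split_ifs <;> simp

theorem ce_apply (b : V →ₗ[R] V →ₗ[R] V) (B : V →ₗ[R] W →ₗ[R] W) {n : ℕ} (F : Form V W n)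
    (v : Fin (n + 1) → V) :
    ce b B F v = ∑ j : Fin (n + 1), (-1 : ℤ) ^ (j : ℕ) • (B (v j) (F (j.removeNth v)) +
      ∑ i : Fin n, if i.castSucc < j then
        F (Function.update (j.removeNth v) i (b (v i.castSucc) (v j))) else 0) := rfl

variable (R) in
/-- `F` is multilinear and alternating. -/
def IsAlt {n : ℕ} (F : Form V W n) : Prop := ∃ H : V [⋀^Fin n]→ₗ[R] W, ⇑H = F

namespace IsAlt

variable {n : ℕ} {F G : Form V W n}

theorem add (hF : IsAlt R F) (hG : IsAlt R G) : IsAlt R (F + G) := by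
  obtain ⟨F, rfl⟩ := hF; obtain ⟨G, rfl⟩ := hG; exact ⟨F + G, rfl⟩

theorem sub (hF : IsAlt R F) (hG : IsAlt R G) : IsAlt R (F - G) := by
  obtain ⟨F, rfl⟩ := hF; obtain ⟨G, rfl⟩ := hG; exact ⟨F - G, rfl⟩

theorem zsmul (hF : IsAlt R F) (c : ℤ) : IsAlt R (c • F) := by
  obtain ⟨F, rfl⟩ := hF; exact ⟨c • F, rfl⟩

theorem smul (hF : IsAlt R F) (c : R) : IsAlt R (c • F) := by
  obtain ⟨F, rfl⟩ := hF; exact ⟨c • F, rfl⟩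

theorem isAlt_post (hF : IsAlt R F) (T : W →ₗ[R] W) : IsAlt R (post T F) := by
  obtain ⟨F, rfl⟩ := hF; exact ⟨T.compAlternatingMap F, rfl⟩

theorem of_zero (F : Form V W 0) : IsAlt R F :=
  ⟨AlternatingMap.constOfIsEmpty R V (Fin 0) (F Fin.elim0), by
    funext v; simp [Subsingleton.elim v Fin.elim0]⟩

variable {F : Form V W (n + 1)}

theorem isAlt_ins (hF : IsAlt R F) (x : V) : IsAlt R (ins x F) := by
  obtain ⟨F, rfl⟩ := hF; exact ⟨F.curryLeft x, rfl⟩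

theorem ins_add_left (hF : IsAlt R F) (x y : V) :
    ins (x + y) F = ins x F + ins y F := by
  obtain ⟨F, rfl⟩ := hF
  funext w
  exact congrArg (fun H => H w) (F.curryLeft.map_add x y)

theorem ins_smul_left (hF : IsAlt R F) (c : R) (x : V) :
    ins (c • x) F = c • ins x F := by
  obtain ⟨F, rfl⟩ := hF
  funext w
  exact congrArg (fun H => H w) (F.curryLeft.map_smul c x)

theorem ins_sub_left (hF : IsAlt R F) (x y : V) :
    ins (x - y) F = ins x F - ins y F := by
  obtain ⟨F, rfl⟩ := hF
  funext w
  exact congrArg (fun H => H w) (F.curryLeft.map_sub x y)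

theorem ins_ins_self {F : Form V W (n + 2)} (hF : IsAlt R F) (x : V) :
    ins x (ins x F) = 0 := by
  obtain ⟨F, rfl⟩ := hF
  funext w
  exact congrArg (fun H => H w) (F.curryLeft_same x)

theorem ins_ins_swap {F : Form V W (n + 2)} (hF : IsAlt R F) (x y : V) :
    ins x (ins y F) = -ins y (ins x F) := by
  have h := hF.ins_ins_self (x + y)
  rw [hF.ins_add_left, ins_add, (hF.isAlt_ins x).ins_add_left, (hF.isAlt_ins y).ins_add_left,
    hF.ins_ins_self, hF.ins_ins_self, zero_add, add_zero] at h
  exact eq_neg_of_add_eq_zero_right h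

/-- Multilinearity and alternation, one argument at a time. -/
theorem intro_succ (hi : ∀ x, IsAlt R (ins x F))
    (hadd : ∀ x y, ins (x + y) F = ins x F + ins y F)
    (hsmul : ∀ (c : R) x, ins (c • x) F = c • ins x F)
    (h0 : ∀ (w : Fin n → V) (j : Fin n), (j : ℕ) = 0 → F (Fin.cons (w j) w) = 0) :
    IsAlt R F := by
  choose H hH using hi
  have hF : ∀ v, F v = H (v 0) (Fin.tail v) := fun v => by
    rw [hH, ins, Fin.cons_self_tail]
  let U : V →ₗ[R] MultilinearMap R (fun _ : Fin n => V) W :=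
    { toFun := fun x => (H x).toMultilinearMap
      map_add' := fun x y => by
        ext w
        have := congrFun (hadd x y) w
        simpa [← hH] using this
      map_smul' := fun c x => by
        ext w
        have := congrFun (hsmul c x) w
        simpa [← hH] using this }
  have hcons : ∀ (w : Fin n → V) (j : Fin n), F (Fin.cons (w j) w) = 0 := by
    intro w j
    obtain rfl | ⟨m, rfl⟩ : n = 0 ∨ ∃ m, n = m + 1 := by cases n <;> simp
    · exact j.elim0
    · by_cases hj : j = 0
      · exact h0 w j (by simp [hj])
      -- Swapping entries `0` and `j` of the tail brings the repeated argument next to the inserted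
      -- one, at the cost of a sign.
      · have h := (H (w j)).map_swap w (i := 0) (j := j) (Ne.symm hj)
        have h1 := h0 (w ∘ Equiv.swap 0 j) 0 rfl
        rw [hF] at h1 ⊢
        simp only [Fin.cons_zero, Fin.tail_cons, Function.comp_apply, Equiv.swap_apply_left]
          at h1 ⊢
        rw [h, neg_eq_zero] at h1
        exact h1
  refine ⟨⟨LinearMap.uncurryLeft (M := fun _ => V) U, ?_⟩, ?_⟩
  · intro v i j hij hne
    change U (v 0) (Fin.tail v) = 0
    change H (v 0) (Fin.tail v) = 0
    induction i using Fin.cases with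
    | zero =>
      induction j using Fin.cases with
      | zero => exact absurd rfl hne
      | succ j =>
        have := hcons (Fin.tail v) j
        rw [hF] at this
        simpa [hij, Fin.tail] using this
    | succ i =>
      induction j using Fin.cases with
      | zero =>
        have := hcons (Fin.tail v) i
        rw [hF] at this
        simpa [← hij, Fin.tail] using this
      | succ j =>
        exact (H (v 0)).map_eq_zero_of_eq (Fin.tail v) (i := i) (j := j) hij
          (fun h => hne (by rw [h]))
  · funext v; rw [hF]; rfl

theorem intro_one {F : Form V W 1}
    (hadd : ∀ x y, ins (x + y) F = ins x F + ins y F)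
    (hsmul : ∀ (c : R) x, ins (c • x) F = c • ins x F) : IsAlt R F :=
  intro_succ (fun _ => of_zero _) hadd hsmul fun _ j => j.elim0

theorem intro_succ_succ {F : Form V W (n + 2)} (hi : ∀ x, IsAlt R (ins x F))
    (hadd : ∀ x y, ins (x + y) F = ins x F + ins y F)
    (hsmul : ∀ (c : R) x, ins (c • x) F = c • ins x F)
    (h0 : ∀ x, ins x (ins x F) = 0) : IsAlt R F := by
  refine intro_succ hi hadd hsmul fun w j hj => ?_
  obtain rfl : j = 0 := Fin.ext hj
  have := congrFun (h0 (w 0)) (Fin.tail w)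
  simpa [ins] using this

end IsAlt

theorem IsAlt.isAlt_der {n : ℕ} {F : Form V W n} (hF : IsAlt R F) (T : V →ₗ[R] V) :
    IsAlt R (der T F) := by
  induction n with
  | zero => exact .of_zero _
  | succ n ih =>
    have hadd : ∀ x y, ins (x + y) (der T F) =
        ins x (der T F) + ins y (der T F) := fun x y => by
      rw [ins_der, ins_der, ins_der, hF.ins_add_left, map_add, map_add, hF.ins_add_left,
        add_add_add_comm]
    have hsmul : ∀ (c : R) x, ins (c • x) (der T F) = c • ins x (der T F) :=
      fun c x => by simp only [ins_der, hF.ins_smul_left, map_smul, smul_add]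
    cases n with
    | zero => exact .intro_one hadd hsmul
    | succ n =>
      refine .intro_succ_succ (fun x => ?_) hadd hsmul fun x => ?_
      · rw [ins_der]; exact (ih (hF.isAlt_ins x)).add (hF.isAlt_ins _)
      · simp only [ins_der, ins_add, hF.ins_ins_self, map_zero, hF.ins_ins_swap x (T x)]; abel

theorem IsAlt.isAlt_lieD {n : ℕ} {F : Form V W n} (hF : IsAlt R F) (b : V →ₗ[R] V →ₗ[R] V)
    (B : V →ₗ[R] W →ₗ[R] W) (x : V) : IsAlt R (lieD b B x F) :=
  (hF.isAlt_post _).sub (hF.isAlt_der _)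

theorem ins_ce_zero (b : V →ₗ[R] V →ₗ[R] V) (B : V →ₗ[R] W →ₗ[R] W) (x : V)
    (F : Form V W 0) : ins x (ce b B F) = lieD b B x F := by
  funext v
  rw [lieD_zero_apply]
  simp [ins, ce_apply, Fin.removeNth_zero]

theorem removeNth_succ_cons {n : ℕ} (j : Fin (n + 1)) (x : V) (w : Fin (n + 1) → V) :
    j.succ.removeNth (Fin.cons x w : Fin (n + 2) → V) =
      (Fin.cons x (j.removeNth w) : Fin (n + 1) → V) :=
  funext (Fin.cases rfl fun _ => by simp [Fin.removeNth])

/-- Moving the first argument back to position `j` past `j` others costs `(-1)^j`, which cancels the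
sign in the sum. -/
theorem IsAlt.sum_ins_removeNth {n : ℕ} {F : Form V W (n + 1)} (hF : IsAlt R F)
    (T : V →ₗ[R] V) (w : Fin (n + 1) → V) :
    ∑ j : Fin (n + 1), (-1 : ℤ) ^ (j : ℕ) •
        F (Fin.cons (T (w j)) (j.removeNth w) : Fin (n + 1) → V) = der T F w := by
  obtain ⟨F, rfl⟩ := hF
  rw [der_apply]
  refine Finset.sum_congr rfl fun j _ => ?_
  rw [← Fin.insertNth_removeNth, AlternatingMap.map_insertNth]
  simp [Matrix.vecCons]

/-- Cartan's formula. With `x` as argument `0`, the term `j = 0` gives the action of `x`, the pairs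
`(0, j)` give the brackets with `x`, and all other terms form the differential of the insertion,
with sign `-1` because indices shift by one. No property of `b` beyond bilinearity enters. -/
theorem ins_ce {b : V →ₗ[R] V →ₗ[R] V} (B : V →ₗ[R] W →ₗ[R] W)
    (x : V) {n : ℕ} {F : Form V W (n + 1)} (hF : IsAlt R F) :
    ins x (ce b B F) = lieD b B x F - ce b B (ins x F) := by
  funext w
  rw [Pi.sub_apply, lieD_apply, Pi.sub_apply, ← hF.sum_ins_removeNth, sub_sub,
    ce_apply, ← Finset.sum_add_distrib, ins, ce_apply, Fin.sum_univ_succ, sub_eq_add_neg,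
    ← Finset.sum_neg_distrib]
  congr 1
  · simp
  · refine Finset.sum_congr rfl fun j _ => ?_
    rw [← smul_add, removeNth_succ_cons, Fin.val_succ, pow_succ, mul_neg_one, neg_smul]
    congr 2
    rw [Fin.sum_univ_succ, Fin.cons_succ, add_left_comm]
    simp [ins, Fin.cons_update]

end CartanCalculus

/-! ### The Chevalley–Eilenberg complex of a Lie algebra -/

section LieRep

variable {R V W : Type*} [CommRing R] [AddCommGroup V] [Module R V] [AddCommGroup W] [Module R W]

/-- `b` is a Lie bracket on `V` and `B` is a representation of it on `W`. -/
structure IsLieRep (b : V →ₗ[R] V →ₗ[R] V) (B : V →ₗ[R] W →ₗ[R] W) : Prop where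
  self : ∀ x, b x x = 0
  jacobi : ∀ x y z, b (b x y) z = b x (b y z) - b y (b x z)
  rep : ∀ x y w, B (b x y) w = B x (B y w) - B y (B x w)

variable {b b' : V →ₗ[R] V →ₗ[R] V} {B B' : V →ₗ[R] W →ₗ[R] W}

theorem IsLieRep.skew (h : IsLieRep b B) (x y : V) : b x y = -b y x := by
  have := h.self (x + y)
  simp only [map_add, LinearMap.add_apply, h.self, zero_add, add_zero] at this
  exact eq_neg_of_add_eq_zero_right this

theorem der_add_left {n : ℕ} {F : Form V W n} (hF : IsAlt R F) (S T : V →ₗ[R] V) :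
    der (S + T) F = der S F + der T F := by
  obtain ⟨F, rfl⟩ := hF
  funext w
  simp [der_apply, Finset.sum_add_distrib]

theorem der_smul_left {n : ℕ} {F : Form V W n} (hF : IsAlt R F) (c : R) (T : V →ₗ[R] V) :
    der (c • T) F = c • der T F := by
  obtain ⟨F, rfl⟩ := hF
  funext w
  simp [der_apply, Finset.smul_sum]

theorem lieD_add_left {n : ℕ} {F : Form V W n} (hF : IsAlt R F) (x y : V) :
    lieD b B (x + y) F = lieD b B x F + lieD b B y F := by
  simp only [lieD_apply, map_add, der_add_left hF]
  exact add_sub_add_comm (post (B x) F) (post (B y) F) (der (b x) F) (der (b y) F)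

theorem lieD_smul_left {n : ℕ} {F : Form V W n} (hF : IsAlt R F) (c : R) (x : V) :
    lieD b B (c • x) F = c • lieD b B x F := by
  simp only [lieD_apply, map_smul, der_smul_left hF, smul_sub]
  rfl

/-- Alternation needs only `b x x = 0`, not Jacobi: inserting `x` twice and applying Cartan's
formula leaves `L_x ι_x F - L_x ι_x F`. -/
theorem IsAlt.isAlt_ce (hb : ∀ x, b x x = 0) {n : ℕ} {F : Form V W n} (hF : IsAlt R F) :
    IsAlt R (ce b B F) := by
  induction n with
  | zero =>
    refine .intro_one (fun x y => ?_) fun c x => ?_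
    · simp only [ins_ce_zero, lieD_add_left hF]
    · simp only [ins_ce_zero, lieD_smul_left hF]
  | succ n ih =>
    refine .intro_succ_succ (fun x => ?_) (fun x y => ?_) (fun c x => ?_) fun x => ?_
    · rw [ins_ce B x hF]; exact (hF.isAlt_lieD b B x).sub (ih (hF.isAlt_ins x))
    · simp only [ins_ce B _ hF, lieD_add_left hF, hF.ins_add_left, map_add]
      abel
    · simp only [ins_ce B _ hF, lieD_smul_left hF, hF.ins_smul_left, map_smul, smul_sub]
    · have h0 : ins (b x x) F = 0 := by
        rw [hb, ← zero_smul R (0 : V), hF.ins_smul_left, zero_smul]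
      rw [ins_ce B x hF, ins_sub, ins_lieD, h0, sub_zero]
      cases n with
      | zero => rw [ins_ce_zero, sub_self]
      | succ n => rw [ins_ce B x (hF.isAlt_ins x), hF.ins_ins_self, map_zero, sub_zero, sub_self]

namespace IsLieRep

theorem lieD_lieD (h : IsLieRep b B) {n : ℕ} {F : Form V W n} (hF : IsAlt R F) (x y : V) :
    lieD b B x (lieD b B y F) - lieD b B y (lieD b B x F) = lieD b B (b x y) F := by
  induction n with
  | zero => funext v; simp [lieD_zero_apply, h.rep]
  | succ n ih =>
    refine form_ext fun z => ?_
    simp only [ins_sub, ins_lieD, map_sub, ← ih (hF.isAlt_ins z), h.jacobi, hF.ins_sub_left]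
    abel

theorem lieD_ce (h : IsLieRep b B) {n : ℕ} {F : Form V W n} (hF : IsAlt R F) (x : V) :
    lieD b B x (ce b B F) = ce b B (lieD b B x F) := by
  induction n with
  | zero =>
    refine form_ext fun y => ?_
    rw [ins_lieD, ins_ce_zero, ins_ce_zero, ins_ce_zero, ← h.lieD_lieD hF]; abel
  | succ n ih =>
    refine form_ext fun y => ?_
    rw [ins_lieD, ins_ce B _ hF, ins_ce B _ hF, ins_ce B _ (hF.isAlt_lieD b B x), ins_lieD,
      ← h.lieD_lieD hF, map_sub, map_sub, ih (hF.isAlt_ins y)]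
    abel

/-- By Cartan's formula `ι_x d d F = L_x d F - d L_x F + d d ι_x F`; the first two terms cancel
since `L_x` commutes with `d`, and the last vanishes by induction. -/
theorem ce_ce (h : IsLieRep b B) {n : ℕ} {F : Form V W n} (hF : IsAlt R F) :
    ce b B (ce b B F) = 0 := by
  induction n with
  | zero =>
    refine form_ext fun x => ?_
    rw [ins_ce B _ (hF.isAlt_ce h.self), ins_ce_zero, h.lieD_ce hF, sub_self]; rfl
  | succ n ih =>
    refine form_ext fun x => ?_
    rw [ins_ce B _ (hF.isAlt_ce h.self), ins_ce B _ hF, map_sub, ih (hF.isAlt_ins x),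
      h.lieD_ce hF, sub_zero, sub_self]; rfl

end IsLieRep

/-- Linearity of the differential in the pair (bracket, action); it turns compatibility of two
brackets into anticommutation of their differentials. -/
theorem ce_add_left {n : ℕ} {F : Form V W n} (hF : IsAlt R F) :
    ce (b + b') (B + B') F = ce b B F + ce b' B' F := by
  obtain ⟨F, rfl⟩ := hF
  funext v
  rw [Pi.add_apply]
  simp only [ce_apply, ← Finset.sum_add_distrib, ← smul_add]
  refine Finset.sum_congr rfl fun j _ => ?_
  rw [add_add_add_comm, ← Finset.sum_add_distrib]
  congr 2
  refine Finset.sum_congr rfl fun i _ => ?_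
  split_ifs <;> simp

end LieRep

/-! ### Nijenhuis operators on Lie algebras and their representations -/

section Nijenhuis

variable {R V W : Type*} [CommRing R] [AddCommGroup V] [Module R V] [AddCommGroup W] [Module R W]

/-- The bracket `b` deformed by `N`. -/
def deformed (b : V →ₗ[R] V →ₗ[R] V) (N : V →ₗ[R] V) : V →ₗ[R] V →ₗ[R] V :=
  b ∘ₗ N + b.compl₂ N - b.compr₂ N

@[simp] theorem deformed_apply (b : V →ₗ[R] V →ₗ[R] V) (N : V →ₗ[R] V) (x y : V) :
    deformed b N x y = b (N x) y + b x (N y) - N (b x y) := rfl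

/-- `N` and `NM` are Nijenhuis operators for the bracket `b` and the representation `B`. -/
structure IsNijenhuisPair (b : V →ₗ[R] V →ₗ[R] V) (B : V →ₗ[R] W →ₗ[R] W) (N : V →ₗ[R] V)
    (NM : W →ₗ[R] W) : Prop extends IsLieRep b B where
  nij : ∀ x y, b (N x) (N y) = N (b (N x) y + b x (N y) - N (b x y))
  nijRep : ∀ x w, B (N x) (NM w) = NM (B (N x) w + B x (NM w) - NM (B x w))

variable {b : V →ₗ[R] V →ₗ[R] V} {B : V →ₗ[R] W →ₗ[R] W} {N : V →ₗ[R] V} {NM : W →ₗ[R] W}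

theorem IsLieRep.deformed (h : IsLieRep b B)
    (hN : ∀ x y, b (N x) (N y) = N (b (N x) y + b x (N y) - N (b x y))) :
    IsLieRep (deformed b N) (B ∘ₗ N) where
  self x := by
    rw [deformed_apply, h.self, map_zero, sub_zero, h.skew, neg_add_cancel]
  jacobi x y z := by
    have e1 := hN (b x y) z
    have e2 := hN x (b y z)
    have e3 := hN y (b x z)
    have f1 := h.jacobi (N x) (N y) z
    have f2 := h.jacobi (N x) y (N z)
    have f3 := h.jacobi x (N y) (N z)
    have g1 := congrArg N (h.jacobi (N x) y z)
    have g2 := congrArg N (h.jacobi x (N y) z)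
    have g3 := congrArg N (h.jacobi x y (N z))
    have g4 := congrArg N (congrArg N (h.jacobi x y z))
    have k1 := hN x y
    have k2 := hN y z
    have k3 := hN x z
    -- `N` of a deformed bracket is folded back to `b (N x) (N y)` before expanding; what remains is
    -- a combination of Jacobi identities with zero, one or two arguments under `N`.
    simp only [deformed_apply, ← k1, ← k2, ← k3]
    simp only [map_add, map_sub, LinearMap.add_apply, LinearMap.sub_apply] at *
    rw [e1, e2, e3, f1, f2, f3]
    linear_combination (norm := module) -g1 - g2 - g3 + g4
  rep x y w := by
    -- `N` is a homomorphism from the deformed bracket to `b`, so the representation pulls back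
    -- along it.
    simp only [LinearMap.comp_apply, deformed_apply, ← hN, h.rep]

/-- The sum `b + b_N` is the deformation of `b` by `id + N`, which is again a Nijenhuis operator.
Hence the two Lie structures are compatible. -/
theorem IsNijenhuisPair.add_deformed (h : IsNijenhuisPair b B N NM) :
    IsLieRep (b + NijLCA.deformed b N) (B + B ∘ₗ N) := by
  have := h.toIsLieRep.deformed (N := LinearMap.id + N) fun x y => by
    have := h.nij x y
    simp only [LinearMap.add_apply, LinearMap.id_apply, map_add, map_sub] at this ⊢
    rw [this]; abel
  convert this using 1
  · ext x y
    simp only [deformed_apply, LinearMap.add_apply, LinearMap.id_apply, map_add]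
    abel
  · ext x y
    simp

/-- The differential of the Nijenhuis operator. -/
def dNij (b : V →ₗ[R] V →ₗ[R] V) (B : V →ₗ[R] W →ₗ[R] W) (N : V →ₗ[R] V) (NM : W →ₗ[R] W)
    {n : ℕ} : Form V W n →ₗ[R] Form V W (n + 1) :=
  ce (deformed b N) (B ∘ₗ N) - post NM ∘ₗ ce b B

theorem dNij_apply {n : ℕ} (F : Form V W n) :
    dNij b B N NM F = ce (deformed b N) (B ∘ₗ N) F - post NM (ce b B F) := rfl

/-- The Lie derivative that belongs to `dNij`. -/
def lieDNij (b : V →ₗ[R] V →ₗ[R] V) (B : V →ₗ[R] W →ₗ[R] W) (N : V →ₗ[R] V) (NM : W →ₗ[R] W)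
    (x : V) {n : ℕ} : Form V W n →ₗ[R] Form V W n :=
  lieD (deformed b N) (B ∘ₗ N) x - post NM ∘ₗ lieD b B x

theorem lieDNij_apply (x : V) {n : ℕ} (F : Form V W n) :
    lieDNij b B N NM x F = lieD (deformed b N) (B ∘ₗ N) x F - post NM (lieD b B x F) := rfl

theorem ins_dNij_zero (x : V) (F : Form V W 0) :
    ins x (dNij b B N NM F) = lieDNij b B N NM x F := by
  rw [dNij_apply, ins_sub, ins_post, ins_ce_zero, ins_ce_zero, lieDNij_apply]

theorem ins_dNij (x : V) {n : ℕ} {F : Form V W (n + 1)} (hF : IsAlt R F) :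
    ins x (dNij b B N NM F) = lieDNij b B N NM x F - dNij b B N NM (ins x F) := by
  rw [dNij_apply, ins_sub, ins_post, ins_ce _ _ hF, ins_ce _ _ hF, lieDNij_apply, dNij_apply,
    map_sub]
  abel

theorem ins_lieDNij (x y : V) {n : ℕ} {F : Form V W (n + 1)} :
    ins y (lieDNij b B N NM x F) = lieDNij b B N NM x (ins y F) - ins (deformed b N x y) F +
      post NM (ins (b x y) F) := by
  rw [lieDNij_apply, ins_sub, ins_post, ins_lieD, ins_lieD, lieDNij_apply, map_sub]
  abel

namespace IsNijenhuisPair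

/-- Rearranged, the condition on a Nijenhuis representation says that `B (N x) - NM ∘ B x` commutes
with `NM`. -/
theorem lieDNij_post (h : IsNijenhuisPair b B N NM) (x : V) {n : ℕ} (F : Form V W n) :
    lieDNij b B N NM x (post NM F) = post NM (lieDNij b B N NM x F) := by
  funext v
  have := h.nijRep x (F v)
  simp only [lieDNij_apply, lieD_apply, der_post, Pi.sub_apply, post_apply, map_sub, map_add,
    LinearMap.comp_apply, deformed] at this ⊢
  rw [this]; abel

theorem dNij_post (h : IsNijenhuisPair b B N NM) {n : ℕ} {F : Form V W n} (hF : IsAlt R F) :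
    dNij b B N NM (post NM F) = post NM (dNij b B N NM F) := by
  induction n with
  | zero =>
    refine form_ext fun x => ?_
    rw [ins_post, ins_dNij_zero, ins_dNij_zero, h.lieDNij_post]
  | succ n ih =>
    refine form_ext fun x => ?_
    rw [ins_post, ins_dNij x hF, ins_dNij x (hF.isAlt_post NM), h.lieDNij_post, ins_post,
      ih (hF.isAlt_ins x), map_sub]

theorem isAlt_dNij (h : IsNijenhuisPair b B N NM) {n : ℕ} {F : Form V W n} (hF : IsAlt R F) :
    IsAlt R (dNij b B N NM F) :=
  (hF.isAlt_ce (h.toIsLieRep.deformed h.nij).self).sub ((hF.isAlt_ce h.self).isAlt_post NM)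

/-- Write `d'` for the differential of the deformed structure. Since `NM` commutes with `d_N = d' -
NM d`, and `d² = d'² = 0`, one gets `d_N² = -NM (d d' + d' d)`. The bracket vanishes because `(d +
d')² = 0` by compatibility. -/
theorem dNij_dNij (h : IsNijenhuisPair b B N NM) {n : ℕ} {F : Form V W n} (hF : IsAlt R F) :
    dNij b B N NM (dNij b B N NM F) = 0 := by
  have hD := h.toIsLieRep.deformed h.nij
  have h1 := hD.ce_ce hF
  have h2 := h.ce_ce hF
  have h3 := h.add_deformed.ce_ce hF
  have hF1 := hF.isAlt_ce (B := B) h.self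
  have hF2 := hF.isAlt_ce (B := B ∘ₗ N) hD.self
  rw [ce_add_left hF, map_add, ce_add_left hF1, ce_add_left hF2, h1, h2, zero_add, add_zero] at h3
  have h4 := h.dNij_post hF1
  rw [dNij_apply F, map_sub, h4, dNij_apply, dNij_apply, h1, h2, zero_sub, map_zero, sub_zero,
    ← neg_add', ← map_add, (add_comm _ _).trans h3, map_zero, neg_zero]

end IsNijenhuisPair

/-- The alternating sum over the sets of arguments to which `N` is not applied. -/
def xi (N : V →ₗ[R] V) (NM : W →ₗ[R] W) {n : ℕ} : Form V W n →ₗ[R] Form V W n where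
  toFun F := fun v => ∑ S : Finset (Fin n), (-1 : ℤ) ^ S.card •
    (NM ^ S.card) (F fun i => if i ∈ S then v i else N (v i))
  map_add' F G := by funext v; simp [Finset.sum_add_distrib]
  map_smul' c F := by funext v; simp [Finset.smul_sum, smul_comm c]

theorem xi_apply {n : ℕ} (F : Form V W n) (v : Fin n → V) :
    xi N NM F v = ∑ S : Finset (Fin n), (-1 : ℤ) ^ S.card •
      (NM ^ S.card) (F fun i => if i ∈ S then v i else N (v i)) := rfl

theorem xi_zero (F : Form V W 0) : xi N NM F = F := by
  funext v
  rw [xi_apply, Fintype.sum_subsingleton _ (∅ : Finset (Fin 0))]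
  simp [Subsingleton.elim v Fin.elim0]
  congr 1
  funext i; exact i.elim0

theorem sum_finset_fin_succ {A : Type*} [AddCommMonoid A] {n : ℕ}
    (f : Finset (Fin (n + 1)) → A) :
    ∑ S, f S = ∑ S : Finset (Fin n), f (S.map (Fin.succEmb n)) +
      ∑ S : Finset (Fin n), f (Finset.cons 0 (S.map (Fin.succEmb n)) (by simp)) := by
  classical
  have h0 : (0 : Fin (n + 1)) ∉ (Finset.univ : Finset (Fin n)).map (Fin.succEmb n) := by simp
  have hu : (Finset.univ : Finset (Finset (Fin (n + 1)))) =
      (insert 0 ((Finset.univ : Finset (Fin n)).map (Fin.succEmb n))).powerset := by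
    rw [← Finset.powerset_univ, Fin.univ_succ, Finset.cons_eq_insert]
    rfl
  have hm : ((Finset.univ : Finset (Fin n)).map (Fin.succEmb n)).powerset =
      (Finset.univ : Finset (Finset (Fin n))).map (Finset.mapEmbedding (Fin.succEmb n)).toEmbedding := by
    ext S
    simp only [Finset.mem_powerset, Finset.subset_map_iff, Finset.mem_map, Finset.mem_univ,
      true_and, Finset.subset_univ]
    exact exists_congr fun T => eq_comm
  rw [hu, Finset.sum_powerset_insert h0, hm, Finset.sum_map, Finset.sum_map]
  simp [Finset.cons_eq_insert]

/-- Split the subsets `S` by whether they contain `0`: if not, `N` is applied to `x`; if so, `x`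
stays and a factor `-NM` appears. This recursion is all that is used about `ξ` in positive degree.
-/
theorem ins_xi (x : V) {n : ℕ} (F : Form V W (n + 1)) :
    ins x (xi N NM F) = xi N NM (ins (N x) F) - post NM (xi N NM (ins x F)) := by
  funext v
  have e1 : ∀ S : Finset (Fin n), (fun i => if i ∈ S.map (Fin.succEmb n) then
      (Fin.cons x v : Fin (n + 1) → V) i else N ((Fin.cons x v : Fin (n + 1) → V) i)) =
      (Fin.cons (N x) fun i => if i ∈ S then v i else N (v i) : Fin (n + 1) → V) := fun S =>
    funext (Fin.cases (by simp) fun i => by simp)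
  have e2 : ∀ S : Finset (Fin n), (fun i => if i ∈ Finset.cons 0 (S.map (Fin.succEmb n))
      (by simp) then (Fin.cons x v : Fin (n + 1) → V) i
        else N ((Fin.cons x v : Fin (n + 1) → V) i)) =
      (Fin.cons x fun i => if i ∈ S then v i else N (v i) : Fin (n + 1) → V) := fun S =>
    funext (Fin.cases (by simp) fun i => by simp)
  rw [ins, xi_apply, sum_finset_fin_succ, Pi.sub_apply, sub_eq_add_neg]
  simp only [e1, e2, Finset.card_map, Finset.card_cons, xi_apply, post_apply, map_sum, map_zsmul,
    ins, pow_succ', neg_mul, one_mul, neg_smul, Finset.sum_neg_distrib, Module.End.mul_apply]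

theorem IsAlt.isAlt_xi (N : V →ₗ[R] V) (NM : W →ₗ[R] W) {n : ℕ} {F : Form V W n}
    (hF : IsAlt R F) : IsAlt R (xi N NM F) := by
  induction n with
  | zero => exact .of_zero _
  | succ n ih =>
    have hadd : ∀ x y, ins (x + y) (xi N NM F) = ins x (xi N NM F) + ins y (xi N NM F) :=
      fun x y => by simp only [ins_xi, hF.ins_add_left, map_add]; abel
    have hsmul : ∀ (c : R) x, ins (c • x) (xi N NM F) = c • ins x (xi N NM F) :=
      fun c x => by simp only [ins_xi, hF.ins_smul_left, map_smul, smul_sub]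
    cases n with
    | zero => exact .intro_one hadd hsmul
    | succ n =>
      refine .intro_succ_succ (fun x => ?_) hadd hsmul fun x => ?_
      · rw [ins_xi]
        exact (ih (hF.isAlt_ins _)).sub ((ih (hF.isAlt_ins _)).isAlt_post NM)
      · simp only [ins_xi, ins_sub, ins_post, map_sub, hF.ins_ins_self, map_zero,
          hF.ins_ins_swap x (N x), map_neg]
        abel

namespace IsNijenhuisPair

/-- The counterpart of `ξ d = d_N ξ` for Lie derivatives, and the input for it through Cartan's
formula. -/
theorem xi_lieD (h : IsNijenhuisPair b B N NM) (x : V) {n : ℕ} {F : Form V W n}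
    (hF : IsAlt R F) :
    xi N NM (lieD b B (N x) F) - post NM (xi N NM (lieD b B x F)) =
      lieDNij b B N NM x (xi N NM F) := by
  induction n with
  | zero =>
    simp only [xi_zero]
    funext v
    simp [lieDNij_apply, lieD_zero_apply]
  | succ n ih =>
    refine form_ext fun y => ?_
    have h1 := ih (hF.isAlt_ins (N y))
    have h2 := ih (hF.isAlt_ins y)
    -- The only use of the Nijenhuis identity on the algebra: it matches the bracket terms produced
    -- by inserting `y`.
    have h3 : N (deformed b N x y) = b (N x) (N y) := (h.nij x y).symm
    simp only [ins_sub, ins_post, ins_xi, ins_lieD, ins_lieDNij, map_sub, h.lieDNij_post, ← h1,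
      ← h2, h3]
    rw [deformed_apply, hF.ins_sub_left, hF.ins_add_left]
    simp only [map_sub, map_add]
    abel

theorem xi_ce (h : IsNijenhuisPair b B N NM) {n : ℕ} {F : Form V W n} (hF : IsAlt R F) :
    xi N NM (ce b B F) = dNij b B N NM (xi N NM F) := by
  induction n with
  | zero =>
    refine form_ext fun x => ?_
    rw [ins_xi, ins_ce_zero, ins_ce_zero, ins_dNij_zero, h.xi_lieD x hF]
  | succ n ih =>
    refine form_ext fun x => ?_
    rw [ins_xi, ins_ce _ _ hF, ins_ce _ _ hF, ins_dNij _ (hF.isAlt_xi N NM), ← h.xi_lieD x hF,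
      ins_xi, map_sub, map_sub, map_sub, map_sub, ih (hF.isAlt_ins _), ih (hF.isAlt_ins _),
      h.dNij_post ((hF.isAlt_ins _).isAlt_xi N NM)]
    abel

end IsNijenhuisPair

end Nijenhuis

/-! ### Polynomials in the `λᵢ` and homomorphisms out of the parameter ring -/

section LamPolyLemmas

variable {M : Type v} [AddCommGroup M] [Module DRing M]
variable {R : Type*} [CommRing R] [Algebra ℂ R]

/-- The element `Q m` of `M[λ₁, …, λₖ]`. -/
noncomputable def lamMk {k : ℕ} (Q : LamRing k) (m : M) : LamPoly k M := Q ⊗ₜ[DRing] m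

theorem lamPoly_hom_ext {k : ℕ} {X : Type*} [AddMonoid X] {f g : LamPoly k M →+ X}
    (h : ∀ Q m, f (lamMk Q m) = g (lamMk Q m)) : f = g :=
  AddMonoidHom.ext fun v => by
    refine TensorProduct.induction_on (R := DRing) (M := LamRing k) (N := M)
      (motive := fun v => f (v : LamPoly k M) = g (v : LamPoly k M)) v
      ((map_zero f).trans (map_zero g).symm) h ?_
    intro (x : LamPoly k M) (y : LamPoly k M) hx hy
    exact (map_add f x y).trans ((congrArg₂ (· + ·) hx hy).trans (map_add g x y).symm)

theorem smul_lamMk {k : ℕ} (P Q : LamRing k) (m : M) : P • lamMk Q m = lamMk (P * Q) m := rfl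

theorem lamMk_add_left {k : ℕ} (P Q : LamRing k) (m : M) :
    lamMk (P + Q) m = lamMk P m + lamMk Q m := TensorProduct.add_tmul P Q m

theorem lamMk_add_right {k : ℕ} (Q : LamRing k) (m m' : M) :
    lamMk Q (m + m') = lamMk Q m + lamMk Q m' := TensorProduct.tmul_add Q m m'

theorem lamMk_smul_right {k : ℕ} (Q : LamRing k) (P : DRing) (m : M) :
    lamMk Q (P • m) = lamMk (MvPolynomial.C P * Q) m := by
  rw [← MvPolynomial.smul_eq_C_mul]
  exact (TensorProduct.smul_tmul P Q m).symm

theorem subst_lamMk {k l : ℕ} (μ : Fin k → LamRing l) (Q : LamRing k) (m : M) :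
    subst μ (lamMk Q m) = lamMk (MvPolynomial.aeval μ Q) m := rfl

theorem complex_smul_lamPoly {k : ℕ} (c : ℂ) (v : LamPoly k M) :
    c • v = algebraMap ℂ (LamRing k) c • v := (algebraMap_smul (LamRing k) c v).symm

theorem coeffs_add {k : ℕ} (v w : LamPoly k M) : coeffs (v + w) = coeffs v + coeffs w :=
  map_add (TensorProduct.equivFinsuppOfBasisLeft (MvPolynomial.basisMonomials (Fin k) DRing)) v w

theorem coeffs_lamMk_monomial {k : ℕ} (a : Fin k →₀ ℕ) (r : DRing) (m : M) :
    coeffs (lamMk (MvPolynomial.monomial a r) m) = Finsupp.single a (r • m) := by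
  refine (TensorProduct.equivFinsuppOfBasisLeft_apply_tmul _ _ _).trans ?_
  change Finsupp.mapRange _ _ (Finsupp.single a r) = _
  rw [Finsupp.mapRange_single]

/-- The homomorphism with `λᵢ ↦ sᵢ` and `∂ ↦ -z`. -/
noncomputable def lamHom {k : ℕ} (s : Fin k → R) (z : R) : LamRing k →ₐ[ℂ] R where
  toRingHom := MvPolynomial.eval₂Hom (Polynomial.aeval (-z) : DRing →ₐ[ℂ] R).toRingHom s
  commutes' c := by
    rw [IsScalarTower.algebraMap_apply ℂ DRing (LamRing k)]
    simp [MvPolynomial.algebraMap_eq]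

@[simp] theorem lamHom_lv {k : ℕ} (s : Fin k → R) (z : R) (i : Fin k) :
    lamHom s z (lv i) = s i :=
  MvPolynomial.eval₂Hom_X' _ _ _

@[simp] theorem lamHom_del {k : ℕ} (s : Fin k → R) (z : R) : lamHom s z (del k) = -z := by
  refine (MvPolynomial.eval₂Hom_C _ _ _).trans ?_
  simp

theorem lamRing_hom_ext {k : ℕ} {φ ψ : LamRing k →ₐ[ℂ] R} (h : ∀ i, φ (lv i) = ψ (lv i))
    (hd : φ (del k) = ψ (del k)) : φ = ψ := by
  have hC : (φ : LamRing k →+* R).comp MvPolynomial.C =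
      (ψ : LamRing k →+* R).comp MvPolynomial.C := by
    refine Polynomial.ringHom_ext (fun c => ?_) hd
    exact (φ.commutes c).trans (ψ.commutes c).symm
  refine AlgHom.coe_ringHom_injective (MvPolynomial.ringHom_ext (fun P => ?_) h)
  exact congrArg (fun f => f P) hC

theorem algHom_C {k : ℕ} (φ : LamRing k →ₐ[ℂ] R) (P : DRing) :
    φ (MvPolynomial.C P) = Polynomial.aeval (φ (del k)) P := by
  have : (φ.comp (IsScalarTower.toAlgHom ℂ DRing (LamRing k))) =
      Polynomial.aeval (φ (del k)) := by
    ext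
    simp [MvPolynomial.algebraMap_eq, del]
  exact congrArg (fun f => f P) this

end LamPolyLemmas

/-! ### The `R`-module `Cur R M` and evaluation of polynomials in it -/

section Cur

variable (R : Type*) [CommRing R] [Algebra ℂ R]
variable (M : Type v) [AddCommGroup M] [Module DRing M]

/-- The relations that define `Cur R M`. -/
noncomputable def curRel : Submodule R ((R × M) →₀ R) :=
  Submodule.span R
    ({x | ∃ (z : R) (m m' : M), x = Finsupp.single (z, m + m') 1 - Finsupp.single (z, m) 1 -
        Finsupp.single (z, m') 1} ∪
      {x | ∃ (z : R) (P : DRing) (m : M), x = Finsupp.single (z, P • m) 1 -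
        Polynomial.aeval (-z) P • Finsupp.single (z, m) 1})

/-- The direct sum over `z : R` of the base changes of `M` along `ℂ[∂] → R`, `∂ ↦ -z`. -/
abbrev Cur : Type _ := ((R × M) →₀ R) ⧸ curRel R M

variable {R M}

/-- The element `m` of the summand of `Cur R M` with index `z`. -/
noncomputable def cur (z : R) : M →+ Cur R M :=
  AddMonoidHom.mk' (fun m => (curRel R M).mkQ (Finsupp.single (z, m) 1)) fun m m' => by
    rw [← map_add, ← sub_eq_zero, ← map_sub, Submodule.mkQ_apply, Submodule.Quotient.mk_eq_zero,
      ← sub_sub]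
    exact Submodule.subset_span (Or.inl ⟨z, m, m', rfl⟩)

theorem cur_smul (z : R) (P : DRing) (m : M) :
    cur z (P • m) = Polynomial.aeval (-z) P • cur z m := by
  change (curRel R M).mkQ _ = _ • (curRel R M).mkQ _
  rw [← map_smul, ← sub_eq_zero, ← map_sub, Submodule.mkQ_apply, Submodule.Quotient.mk_eq_zero]
  exact Submodule.subset_span (Or.inr ⟨z, P, m, rfl⟩)

theorem Cur.induction {p : Cur R M → Prop} (x : Cur R M) (hcur : ∀ z m, p (cur z m))
    (hadd : ∀ x y, p x → p y → p (x + y)) (hsmul : ∀ (r : R) x, p x → p (r • x)) : p x := by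
  obtain ⟨x, rfl⟩ := (curRel R M).mkQ_surjective x
  induction x using Finsupp.induction_linear with
  | zero =>
    have := hsmul 0 _ (hcur 0 0)
    rw [zero_smul] at this
    rwa [map_zero]
  | add x y hx hy => rw [map_add]; exact hadd _ _ hx hy
  | single a r =>
    have := hsmul r _ (hcur a.1 a.2)
    have h : Finsupp.single a r = r • Finsupp.single (a.1, a.2) (1 : R) := by simp
    rw [h, map_smul]; exact this

variable {W : Type*} [AddCommGroup W] [Module R W]

theorem Cur.hom_ext {f g : Cur R M →ₗ[R] W} (h : ∀ z m, f (cur z m) = g (cur z m)) : f = g := by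
  refine LinearMap.ext fun x => ?_
  induction x using Cur.induction with
  | hcur z m => exact h z m
  | hadd x y hx hy => rw [map_add, map_add, hx, hy]
  | hsmul r x hx => rw [map_smul, map_smul, hx]

/-- The condition for `φ : R × M → W` to extend to `Cur R M`. -/
structure CurCompat (φ : R → M → W) : Prop where
  add : ∀ z m m', φ z (m + m') = φ z m + φ z m'
  smul : ∀ z (P : DRing) m, φ z (P • m) = Polynomial.aeval (-z) P • φ z m

/-- Constants and `∂` generate `ℂ[∂]`, so the axioms on `∂` that define brackets, actions and
cochains suffice. -/
theorem CurCompat.of_X [Module ℂ M] [IsScalarTower ℂ DRing M] {φ : R → M → W}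
    (add : ∀ z m m', φ z (m + m') = φ z m + φ z m')
    (csmul : ∀ z (c : ℂ) m, φ z (c • m) = algebraMap ℂ R c • φ z m)
    (X : ∀ z m, φ z ((Polynomial.X : DRing) • m) = -(z • φ z m)) : CurCompat φ := by
  refine ⟨add, fun z P m => ?_⟩
  induction P using Polynomial.induction_on generalizing m with
  | C c =>
    have h : (Polynomial.C c : DRing) • m = c • m := algebraMap_smul DRing c m
    rw [h, csmul, Polynomial.aeval_C]
  | add p q hp hq => rw [add_smul, add, hp, hq, map_add, add_smul]
  | monomial n c h =>
    rw [pow_succ, ← mul_assoc, mul_smul, h, X, map_mul _ _ Polynomial.X, Polynomial.aeval_X,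
      mul_smul, neg_smul]

/-- The linear map on `Cur R M` that extends `φ`. -/
noncomputable def CurCompat.lift {φ : R → M → W} (h : CurCompat φ) : Cur R M →ₗ[R] W :=
  (curRel R M).liftQ (Finsupp.linearCombination R fun x : R × M => φ x.1 x.2) <| by
    refine Submodule.span_le.2 ?_
    rintro _ (⟨z, m, m', rfl⟩ | ⟨z, P, m, rfl⟩)
    · simp [h.add]
    · simp [h.smul]

@[simp] theorem CurCompat.lift_cur {φ : R → M → W} (h : CurCompat φ) (z : R) (m : M) :
    h.lift (cur z m) = φ z m := by
  refine ((curRel R M).liftQ_apply _ _).trans ?_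
  simp

/-- The map of `Cur R M` induced by a `ℂ[∂]`-linear map. -/
noncomputable def curMap (R : Type*) [CommRing R] [Algebra ℂ R] (T : M →ₗ[DRing] M) :
    Cur R M →ₗ[R] Cur R M :=
  CurCompat.lift (φ := fun z m => cur z (T m))
    ⟨fun z m m' => by simp, fun z P m => by rw [map_smul, cur_smul]⟩

@[simp] theorem curMap_cur (T : M →ₗ[DRing] M) (z : R) (m : M) :
    curMap R T (cur z m) = cur z (T m) := CurCompat.lift_cur _ z m

/-- Evaluation of `M[λ₁, …, λₖ]` in `Cur R M` along `φ : ℂ[∂][λ₁, …, λₖ] → R`. -/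
noncomputable def ev {k : ℕ} (φ : LamRing k →ₐ[ℂ] R) : LamPoly k M →+ Cur R M :=
  TensorProduct.liftAddHom
    (AddMonoidHom.mk' (fun Q => AddMonoidHom.mk' (fun m => φ Q • cur (-φ (del k)) m)
      fun m m' => by rw [map_add, smul_add])
      fun Q Q' => by ext m; simp [add_smul])
    fun P Q m => by
      change φ (P • Q) • cur (-φ (del k)) m = φ Q • cur (-φ (del k)) (P • m)
      rw [cur_smul, neg_neg, ← algHom_C, smul_smul, ← map_mul, MvPolynomial.smul_eq_C_mul,
        mul_comm]

theorem ev_lamMk {k : ℕ} (φ : LamRing k →ₐ[ℂ] R) (Q : LamRing k) (m : M) :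
    ev φ (lamMk Q m) = φ Q • cur (-φ (del k)) m := rfl

theorem ev_smul {k : ℕ} (φ : LamRing k →ₐ[ℂ] R) (P : LamRing k) (v : LamPoly k M) :
    ev φ (P • v) = φ P • ev φ v := by
  have : (ev φ).comp (DistribSMul.toAddMonoidHom (LamPoly k M) P) =
      (DistribSMul.toAddMonoidHom (Cur R M) (φ P)).comp (ev φ) := by
    refine lamPoly_hom_ext fun Q m => ?_
    change ev φ (P • lamMk Q m) = φ P • ev φ (lamMk Q m)
    rw [smul_lamMk, ev_lamMk, ev_lamMk, map_mul, mul_smul]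
  exact congrArg (fun f => f v) this

theorem ev_csmul {k : ℕ} (φ : LamRing k →ₐ[ℂ] R) (c : ℂ) (v : LamPoly k M) :
    ev φ (c • v) = algebraMap ℂ R c • ev φ v := by
  rw [complex_smul_lamPoly, ev_smul, AlgHom.commutes]

theorem ev_subst {k l : ℕ} {φ : LamRing l →ₐ[ℂ] R} (ψ : LamRing k →ₐ[ℂ] R)
    {μ : Fin k → LamRing l} (h : ∀ i, φ (μ i) = ψ (lv i)) (hd : φ (del l) = ψ (del k))
    (v : LamPoly k M) : ev φ (subst μ v) = ev ψ v := by
  have hφ : φ.comp ((MvPolynomial.aeval μ : LamRing k →ₐ[DRing] LamRing l).restrictScalars ℂ) =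
      ψ := by
    refine lamRing_hom_ext (fun i => ?_) ?_
    · rw [← h]
      exact congrArg φ (MvPolynomial.aeval_X μ i)
    · rw [← hd]
      exact congrArg φ (MvPolynomial.aeval_C μ _)
  have : (ev φ).comp (subst μ : LamPoly k M →ₗ[DRing] LamPoly l M).toAddMonoidHom = ev ψ := by
    refine lamPoly_hom_ext fun Q m => ?_
    change ev φ (subst μ (lamMk Q m)) = _
    rw [subst_lamMk, ev_lamMk, ev_lamMk, hd, ← hφ]
    rfl
  exact congrArg (fun f => f v) this

theorem ev_ext {k : ℕ} (φ : LamRing k →ₐ[ℂ] R) (T : M →ₗ[DRing] M) (v : LamPoly k M) :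
    ev φ (ext k T v) = curMap R T (ev φ v) := by
  have : (ev φ).comp (ext k T).toAddMonoidHom =
      (curMap R T).toAddMonoidHom.comp (ev φ) := by
    refine lamPoly_hom_ext fun Q m => ?_
    change ev φ (lamMk Q (T m)) = curMap R T (ev φ (lamMk Q m))
    rw [ev_lamMk, ev_lamMk, map_smul, curMap_cur]
  exact congrArg (fun f => f v) this

theorem ev_eq_sum_coeffs {k : ℕ} (φ : LamRing k →ₐ[ℂ] R) (v : LamPoly k M) :
    ev φ v = (coeffs v).sum fun a m => (∏ i, φ (lv i) ^ a i) • cur (-φ (del k)) m := by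
  have hadd : ∀ v w : LamPoly k M, ((coeffs (v + w)).sum fun a m =>
      (∏ i, φ (lv i) ^ a i) • cur (-φ (del k)) m) =
      ((coeffs v).sum fun a m => (∏ i, φ (lv i) ^ a i) • cur (-φ (del k)) m) +
      (coeffs w).sum fun a m => (∏ i, φ (lv i) ^ a i) • cur (-φ (del k)) m := fun v w => by
    rw [coeffs_add, Finsupp.sum_add_index'] <;> simp
  have : ev φ = AddMonoidHom.mk' (fun v : LamPoly k M => (coeffs v).sum fun a m =>
      (∏ i, φ (lv i) ^ a i) • cur (-φ (del k)) m) hadd := by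
    refine lamPoly_hom_ext fun Q m => ?_
    induction Q using MvPolynomial.induction_on' with
    | monomial a r =>
      rw [ev_lamMk, AddMonoidHom.mk'_apply, coeffs_lamMk_monomial, Finsupp.sum_single_index (by simp),
        cur_smul, neg_neg, ← algHom_C, MvPolynomial.monomial_eq, map_mul, mul_comm, mul_smul,
        Finsupp.prod_fintype _ _ (by simp), map_prod]
      simp only [map_pow, lv]
    | add P Q hP hQ => rw [lamMk_add_left, map_add, hP, hQ, map_add]
  exact congrArg (fun f => f v) this

/-- The common step for `opAct`, `opComp` and the bracket terms of `ceSum`: if evaluating `F c` is a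
linear function of `c` in the relevant summand, coefficientwise application becomes plain
application of that linear map. -/
theorem ev_evalWith {A : Type u} [AddCommGroup A] [Module DRing A] {k l : ℕ}
    {φ : LamRing l →ₐ[ℂ] R} (ψ : LamRing k →ₐ[ℂ] R) {μ : Fin k → LamRing l}
    (h : ∀ i, φ (μ i) = ψ (lv i)) {F : A → LamPoly l M} (Φ : Cur R A →ₗ[R] Cur R M)
    (hF : ∀ c, ev φ (F c) = Φ (cur (-ψ (del k)) c)) (v : LamPoly k A) :
    ev φ (evalWith μ F v) = Φ (ev ψ v) := by
  rw [evalWith, map_finsuppSum, ev_eq_sum_coeffs ψ, map_finsuppSum]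
  refine Finsupp.sum_congr fun a _ => ?_
  rw [ev_smul, hF, map_smul, map_prod]
  simp only [map_pow, h]

/-- At the identity, evaluation lands in the summand of index `-∂`, where `∂` acts as itself. That
summand is `M[λ₁, …, λₖ]`, and the projection `π` onto it is a left inverse. -/
theorem ev_id_injective {k : ℕ} :
    Function.Injective (ev (AlgHom.id ℂ (LamRing k)) : LamPoly k M →+ Cur (LamRing k) M) := by
  classical
  let π : Cur (LamRing k) M →ₗ[LamRing k] LamPoly k M :=
    CurCompat.lift (φ := fun z m => if z = -del k then lamMk 1 m else 0) <| by
      refine ⟨fun z m m' => ?_, fun z P m => ?_⟩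
      · split_ifs
        · exact lamMk_add_right _ _ _
        · rw [add_zero]
      · split_ifs with h
        · have hP := algHom_C (AlgHom.id ℂ (LamRing k)) P
          simp only [AlgHom.coe_id, id_eq] at hP
          rw [h, neg_neg, lamMk_smul_right, smul_lamMk, ← hP]
        · rw [smul_zero]
  have : π.toAddMonoidHom.comp (ev (AlgHom.id ℂ (LamRing k))) = AddMonoidHom.id _ := by
    refine lamPoly_hom_ext fun Q m => ?_
    change π (ev _ (lamMk Q m)) = lamMk Q m
    rw [ev_lamMk, map_smul, CurCompat.lift_cur]
    simp [smul_lamMk]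
  exact Function.LeftInverse.injective (g := π) fun v => congrArg (fun f => f v) this

end Cur

/-! ### Bilinear maps induced by `λ`-actions -/

section Brackets

variable {R : Type*} [CommRing R] [Algebra ℂ R]
variable {A : Type u} [AddCommGroup A] [Module ℂ A] [Module DRing A] [IsScalarTower ℂ DRing A]
variable {M : Type v} [AddCommGroup M] [Module ℂ M] [Module DRing M] [IsScalarTower ℂ DRing M]

/-- `Bh` is the bilinear map on `Cur R A × Cur R M` induced by the `λ`-action `B`. -/
def Induces (B : A → M → LamPoly 1 M) (Bh : Cur R A →ₗ[R] Cur R M →ₗ[R] Cur R M) : Prop :=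
  ∀ s t p m, Bh (cur s p) (cur t m) = ev (lamHom ![s] (s + t)) (B p m)

theorem exists_induces (B : A →ₗ[ℂ] M →ₗ[ℂ] LamPoly 1 M)
    (hl : ∀ p m, B ((Polynomial.X : DRing) • p) m = -((lv 0 : LamRing 1) • B p m))
    (hr : ∀ p m, B p ((Polynomial.X : DRing) • m) = (del 1 + lv 0) • B p m) :
    ∃ Bh : Cur R A →ₗ[R] Cur R M →ₗ[R] Cur R M, Induces (fun p m => B p m) Bh := by
  have h1 : ∀ (s : R) (p : A),
      CurCompat fun (t : R) (m : M) => ev (lamHom ![s] (s + t)) (B p m) := fun s p => by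
    refine .of_X (fun t m m' => ?_) (fun t c m => ?_) fun t m => ?_
    · rw [map_add, map_add]
    · rw [map_smul, ev_csmul]
    -- At `λ = s` and `∂ = -(s + t)` the factor `∂ + λ` becomes `-t`, the action of `∂` in the
    -- summand of index `t`.
    · rw [hr, ev_smul, map_add, lamHom_del, lamHom_lv, ← neg_smul]
      congr 1
      simp
  have h2 : CurCompat fun (s : R) (p : A) => (h1 s p).lift := by
    refine .of_X (fun s p p' => ?_) (fun s c p => ?_) fun s p => ?_ <;>
      refine Cur.hom_ext fun t m => ?_
    · simp
    · simp [ev_csmul]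
    · simp [hl, ev_smul]
  exact ⟨h2.lift, fun s t p m => by simp⟩

/-- The hypothesis `hd` is bookkeeping of indices: acting by `p` in summand `φ s` raises the index
of `v` by `φ s`, and an index is minus the value of `∂`. -/
theorem ev_opAct {B : A → M → LamPoly 1 M} {Bh : Cur R A →ₗ[R] Cur R M →ₗ[R] Cur R M}
    (hB : Induces B Bh) {k l : ℕ} {φ : LamRing l →ₐ[ℂ] R} (ψ : LamRing k →ₐ[ℂ] R) (p : A)
    (s : LamRing l) {μ : Fin k → LamRing l} (h : ∀ i, φ (μ i) = ψ (lv i))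
    (hd : φ (del l) + φ s = ψ (del k)) (v : LamPoly k M) :
    ev φ (opAct B p s μ v) = Bh (cur (φ s) p) (ev ψ v) := by
  refine ev_evalWith ψ h _ (fun m => ?_) v
  rw [hB]
  refine ev_subst _ (fun i => ?_) ?_ _
  · fin_cases i; simp
  · simp [← hd]

theorem ev_opComp {B : A → M → LamPoly 1 M} {Bh : Cur R A →ₗ[R] Cur R M →ₗ[R] Cur R M}
    (hB : Induces B Bh) {l : ℕ} {φ : LamRing l →ₐ[ℂ] R} (ψ : LamRing 1 →ₐ[ℂ] R)
    (w : LamPoly 1 A) (s t : LamRing l) (hs : φ s = ψ (lv 0)) (ht : φ t = -ψ (del 1)) (m : M) :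
    ev φ (opComp B w s t m) = Bh (ev ψ w) (cur (-φ (del l) - φ t) m) := by
  refine ev_evalWith ψ (fun i => by fin_cases i; simpa using hs) (Bh.flip _) (fun c => ?_) w
  rw [LinearMap.flip_apply, hB]
  refine ev_subst _ (fun i => ?_) ?_ _
  · fin_cases i; simp [ht]
  · simp [ht]

end Brackets

/-! ### `Cur R L` as a Lie algebra with Nijenhuis operator -/

section Lie

variable {R : Type*} [CommRing R] [Algebra ℂ R]
variable {L : Type u} [AddCommGroup L] [Module ℂ L] [Module DRing L]
  [IsScalarTower ℂ DRing L] [LieConformalAlgebra L]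
variable {M : Type v} [AddCommGroup M] [Module ℂ M] [Module DRing M] [IsScalarTower ℂ DRing M]
variable {b : Cur R L →ₗ[R] Cur R L →ₗ[R] Cur R L} {B : Cur R L →ₗ[R] Cur R M →ₗ[R] Cur R M}

theorem eq_zero_of_add_self {W : Type*} [AddCommGroup W] [Module R W] {w : W}
    (h : w + w = 0) : w = 0 := by
  have h2 : algebraMap ℂ R 2⁻¹ • (w + w) = w := by
    rw [← two_smul R w, smul_smul, ← map_ofNat (algebraMap ℂ R) 2, ← map_mul]
    norm_num
  rw [← h2, h, smul_zero]

theorem Induces.skew (hb : Induces (br (L := L)) b) (x y : Cur R L) : b x y = -b y x := by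
  induction x using Cur.induction with
  | hadd x x' hx hx' => simp only [map_add, LinearMap.add_apply, hx, hx', neg_add]
  | hsmul r x hx => simp only [map_smul, LinearMap.smul_apply, hx, smul_neg]
  | hcur s p =>
    induction y using Cur.induction with
    | hadd y y' hy hy' => simp only [map_add, LinearMap.add_apply, hy, hy', neg_add]
    | hsmul r y hy => simp only [map_smul, LinearMap.smul_apply, hy, smul_neg]
    | hcur t q =>
      rw [hb, hb, br, LieConformalAlgebra.skew, map_neg]
      congr 1
      -- With `λ = s` and `∂ = -(s + t)`, the substituted parameter `-∂ - λ` is `t`.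
      refine ev_subst _ (fun i => ?_) ?_ _
      · fin_cases i; simp
      · simp [add_comm]

theorem Induces.rep (hb : Induces (br (L := L)) b) {ρ : ConformalRep L M}
    (hB : Induces (fun p m => ρ.act p m) B) (x y : Cur R L) (w : Cur R M) :
    B (b x y) w = B x (B y w) - B y (B x w) := by
  induction x using Cur.induction with
  | hadd x x' hx hx' => simp only [map_add, LinearMap.add_apply, hx, hx']; abel
  | hsmul r x hx => simp only [map_smul, LinearMap.smul_apply, hx, smul_sub]
  | hcur s p =>
    induction y using Cur.induction with
    | hadd y y' hy hy' => simp only [map_add, LinearMap.add_apply, hy, hy']; abel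
    | hsmul r y hy => simp only [map_smul, LinearMap.smul_apply, hy, smul_sub]
    | hcur t q =>
      induction w using Cur.induction with
      | hadd w w' hw hw' => simp only [map_add, hw, hw']; abel
      | hsmul r w hw => simp only [map_smul, hw, smul_sub]
      | hcur z m =>
        -- The conformal identity is evaluated at `λ = s`, `μ = t`, in the summand of the total
        -- index `s + t + z`.
        let φ : LamRing 2 →ₐ[ℂ] R := lamHom ![s, t] (s + t + z)
        have h := congrArg (ev φ) (ρ.comm p q m)
        rw [map_sub, ev_opComp hB (lamHom ![s] (s + t)) _ _ _ (by simp [φ]) (by simp [φ]),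
          ev_opAct hB (lamHom ![t] (t + z)) _ _ (fun i => by fin_cases i; simp [φ])
            (by simp [φ]; ring),
          ev_opAct hB (lamHom ![s] (s + z)) _ _ (fun i => by fin_cases i; simp [φ])
            (by simp [φ]; ring), ← hb, ← hB, ← hB] at h
        simpa [φ] using h

theorem Induces.isLieRep (hb : Induces (br (L := L)) b) {ρ : ConformalRep L M}
    (hB : Induces (fun p m => ρ.act p m) B) : IsLieRep b B where
  self x := eq_zero_of_add_self (R := R) (eq_neg_iff_add_eq_zero.1 (hb.skew x x))
  jacobi := hb.rep (ρ := adjoint L) hb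
  rep := hb.rep hB

theorem Induces.nijenhuis {A : Type u} [AddCommGroup A] [Module DRing A]
    {C : A → M → LamPoly 1 M} {Ch : Cur R A →ₗ[R] Cur R M →ₗ[R] Cur R M} (hC : Induces C Ch)
    {N : A →ₗ[DRing] A} {NM : M →ₗ[DRing] M}
    (h : ∀ p m, C (N p) (NM m) = ext 1 NM (C (N p) m + C p (NM m) - ext 1 NM (C p m)))
    (x : Cur R A) (w : Cur R M) :
    Ch (curMap R N x) (curMap R NM w) = curMap R NM
      (Ch (curMap R N x) w + Ch x (curMap R NM w) - curMap R NM (Ch x w)) := by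
  induction x using Cur.induction with
  | hadd x x' hx hx' =>
    simp only [map_add, LinearMap.add_apply, hx, hx', map_sub]; abel
  | hsmul r x hx =>
    simp only [map_smul, LinearMap.smul_apply, hx, ← smul_add, ← smul_sub]
  | hcur s p =>
    induction w using Cur.induction with
    | hadd w w' hw hw' => simp only [map_add, hw, hw', map_sub]; abel
    | hsmul r w hw => simp only [map_smul, hw, ← smul_add, ← smul_sub]
    | hcur t m => simp only [curMap_cur, hC s t, h, ev_ext, map_add, map_sub]

theorem Induces.comp {A : Type u} [AddCommGroup A] [Module DRing A]
    {C : A → M → LamPoly 1 M} {Ch : Cur R A →ₗ[R] Cur R M →ₗ[R] Cur R M} (hC : Induces C Ch)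
    (N : A →ₗ[DRing] A) : Induces (fun p m => C (N p) m) (Ch ∘ₗ curMap R N) := fun s t p m => by
  rw [LinearMap.comp_apply, curMap_cur, hC]

theorem Induces.deformed (hb : Induces (br (L := L)) b) (N : L →ₗ[DRing] L) :
    Induces (brN N) (deformed b (curMap R N)) := fun s t p q => by
  rw [deformed_apply, curMap_cur, curMap_cur, hb, hb, hb, brN, map_sub, map_add, ev_ext]

end Lie

/-! ### Multilinear maps on `Cur R A` -/

section Multilinear

variable {R : Type*} [CommRing R] [Algebra ℂ R]
variable {A : Type u} [AddCommGroup A] [Module DRing A]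
variable {W : Type*} [AddCommGroup W] [Module R W]

theorem cur_multilinear_ext {n : ℕ} {F G : MultilinearMap R (fun _ : Fin n => Cur R A) W}
    (h : ∀ (s : Fin n → R) (p : Fin n → A),
      F (fun i => cur (s i) (p i)) = G (fun i => cur (s i) (p i))) : F = G := by
  induction n with
  | zero =>
    ext v
    rw [Subsingleton.elim v fun i => cur ((fun _ => 0 : Fin 0 → R) i) ((fun _ => 0 : Fin 0 → A) i)]
    exact h _ _
  | succ n ih =>
    have key : F.curryLeft = G.curryLeft := by
      refine Cur.hom_ext fun z m => ih fun s p => ?_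
      have := h (Fin.cons z s) (Fin.cons m p)
      simp only [MultilinearMap.curryLeft_apply]
      convert this using 2 <;> exact funext (Fin.cases rfl fun _ => rfl)
    rw [← F.uncurry_curryLeft, key, G.uncurry_curryLeft]

theorem exists_cur_multilinear {n : ℕ} (F : (Fin n → R) → (Fin n → A) → W)
    (h : ∀ s p i, CurCompat fun z m => F (Function.update s i z) (Function.update p i m)) :
    ∃ G : MultilinearMap R (fun _ : Fin n => Cur R A) W,
      ∀ s p, G (fun i => cur (s i) (p i)) = F s p := by
  induction n with
  | zero =>
    refine ⟨MultilinearMap.constOfIsEmpty R _ (F Fin.elim0 Fin.elim0), fun s p => ?_⟩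
    rw [Subsingleton.elim s Fin.elim0, Subsingleton.elim p Fin.elim0]; rfl
  | succ n ih =>
    have h' : ∀ z m, ∃ G : MultilinearMap R (fun _ : Fin n => Cur R A) W,
        ∀ s p, G (fun i => cur (s i) (p i)) = F (Fin.cons z s) (Fin.cons m p) := fun z m =>
      ih (fun s p => F (Fin.cons z s) (Fin.cons m p)) fun s p i => by
        simpa only [Fin.cons_update] using h (Fin.cons z s) (Fin.cons m p) i.succ
    choose G hG using h'
    have h0 : ∀ (s : Fin n → R) (p : Fin n → A),
        CurCompat fun z m => F (Fin.cons z s) (Fin.cons m p) := fun s p => by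
      -- The two zeros are placeholders, overwritten by the update at position `0`.
      simpa only [Fin.update_cons_zero] using h (Fin.cons 0 s) (Fin.cons 0 p) 0
    have hc : CurCompat G := by
      refine ⟨fun z m m' => ?_, fun z P m => ?_⟩ <;> refine cur_multilinear_ext fun s p => ?_
      · simp only [add_apply, hG, (h0 s p).add]
      · simp only [smul_apply, hG, (h0 s p).smul]
    refine ⟨LinearMap.uncurryLeft (M := fun _ : Fin (n + 1) => Cur R A) hc.lift, fun s p => ?_⟩
    rw [LinearMap.uncurryLeft_apply, hc.lift_cur]
    refine (hG _ _ (Fin.tail s) (Fin.tail p)).trans ?_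
    rw [Fin.cons_self_tail, Fin.cons_self_tail]

end Multilinear

/-! ### Cochains as alternating forms on `Cur R L` -/

section Extension

variable {R : Type*} [CommRing R] [Algebra ℂ R]
variable {L : Type u} [AddCommGroup L] [Module ℂ L] [Module DRing L] [IsScalarTower ℂ DRing L]
variable {M : Type v} [AddCommGroup M] [Module ℂ M] [Module DRing M] [IsScalarTower ℂ DRing M]

/-- Evaluation of the values of `n`-cochains at `λᵢ = sᵢ`, in the summand of `Cur R M` with index
`∑ i, sᵢ`. -/
noncomputable def evCoch : ∀ {n : ℕ}, (Fin n → R) → CochVal M n →+ Cur R M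
  | 0, _ => (QuotientAddGroup.lift (delRange M).toAddSubgroup (cur (R := R) (0 : R)) (by
      rintro _ ⟨m, rfl⟩
      -- In the summand of index `0`, the empty sum, `∂` acts as zero; hence values in `M / ∂M` can
      -- be evaluated there.
      change cur 0 ((Polynomial.X : DRing) • m) = 0
      rw [cur_smul]
      simp) : M ⧸ (delRange M).toAddSubgroup →+ Cur R M)
  | k + 1, s => (ev (lamHom (fun i => s i.castSucc) (∑ i, s i)) : LamPoly k M →+ Cur R M)

theorem evCoch_csmul {n : ℕ} (s : Fin n → R) (c : ℂ) (v : CochVal M n) :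
    evCoch s (c • v) = algebraMap ℂ R c • evCoch s v := by
  cases n with
  | zero =>
    obtain ⟨m, rfl⟩ := (delRange M).mkQ_surjective v
    change cur (0 : R) (c • m) = _ • cur 0 m
    rw [← algebraMap_smul DRing c m, cur_smul]
    simp
  | succ k => exact ev_csmul (M := M) _ c v

/-- `F` is the extension to `Cur R L` of the cochain `f`. -/
def Extends {n : ℕ} (F : Form (Cur R L) (Cur R M) n) (f : RawCochain L M n) : Prop :=
  ∀ (s : Fin n → R) (p : Fin n → L), F (fun i => cur (s i) (p i)) = evCoch s (f p)

theorem Extends.succ {k : ℕ} {F : Form (Cur R L) (Cur R M) (k + 1)}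
    {f : (Fin (k + 1) → L) → LamPoly k M} (h : Extends (n := k + 1) F f) (s : Fin (k + 1) → R)
    (p : Fin (k + 1) → L) :
    F (fun i => cur (s i) (p i)) = ev (lamHom (fun i => s i.castSucc) (∑ i, s i)) (f p) := h s p

/-- For the last index, `-∂ - λ₁ - ⋯ - λₖ` goes to the full sum of the `sᵢ` minus all but the last.
-/
theorem lamHom_lam {k : ℕ} (s : Fin (k + 1) → R) (i : Fin (k + 1)) :
    lamHom (fun i => s i.castSucc) (∑ i, s i) (lam k i) = s i := by
  induction i using Fin.lastCases with
  | last => simp [lam, Fin.sum_univ_castSucc]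
  | cast i => simp [lam]

theorem sum_lam (k : ℕ) : ∑ i, lam k i = -del k := by
  simp [lam, Fin.sum_univ_castSucc]

theorem lamHom_lam_eq_id (k : ℕ) :
    lamHom (fun i => lam k i.castSucc) (∑ i, lam k i) = AlgHom.id ℂ (LamRing k) :=
  lamRing_hom_ext (fun i => by simp [lam]) (by simp [sum_lam])

theorem ev_evalAt {k l : ℕ} {φ : LamRing l →ₐ[ℂ] R} (f : (Fin (k + 1) → L) → LamPoly k M)
    {μ : Fin (k + 1) → LamRing l} {s : Fin (k + 1) → R} (h : ∀ i, φ (μ i) = s i)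
    (hd : φ (del l) = -∑ i, s i) (p : Fin (k + 1) → L) :
    ev φ (evalAt f μ p) = ev (lamHom (fun i => s i.castSucc) (∑ i, s i)) (f p) :=
  ev_subst _ (fun i => by rw [h, lamHom_lv]) (by rw [hd, lamHom_del]) _

/-- Sesquilinearity in each argument gives the multilinear extension. Conformal skew-symmetry says
that permuting arguments multiplies it by the sign; it is then alternating because 2 is invertible
in `R`. -/
theorem exists_extends_of_isCochain {k : ℕ} {f : (Fin (k + 1) → L) → LamPoly k M}
    (hf : IsCochain f) :
    ∃ F : Form (Cur R L) (Cur R M) (k + 1), IsAlt R F ∧ Extends F f := by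
  obtain ⟨G, hG⟩ := exists_cur_multilinear
    (fun (s : Fin (k + 1) → R) (p : Fin (k + 1) → L) =>
      ev (lamHom (fun i => s i.castSucc) (∑ i, s i)) (f p)) fun s p i => by
    refine .of_X (fun z m m' => ?_) (fun z c m => ?_) fun z m => ?_
    · rw [hf.map_add, map_add]
    · rw [hf.map_smul, ev_csmul]
    · have h := hf.sesq (Function.update p i m) i
      rw [Function.update_self, Function.update_idem] at h
      rw [h, map_neg, ev_smul, lamHom_lam, Function.update_self]
  have hskew : ∀ (τ : Equiv.Perm (Fin (k + 1))),
      G.domDomCongr τ = ((Equiv.Perm.sign τ : ℤˣ) : ℤ) • G := fun τ => by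
    refine cur_multilinear_ext fun s p => ?_
    have h := congrArg (ev (lamHom (fun i => s i.castSucc) (∑ i, s i))) (hf.skew τ p)
    rw [ev_evalAt f (μ := lam k ∘ τ) (s := s ∘ τ) (fun i => lamHom_lam s (τ i))
      (by rw [lamHom_del, ← Equiv.sum_comp τ s]; rfl), map_zsmul] at h
    rw [MultilinearMap.domDomCongr_apply, smul_apply, hG s p]
    exact (hG (s ∘ τ) (p ∘ τ)).trans h
  refine ⟨G, ⟨⟨G, fun v i j hv hij => ?_⟩, rfl⟩, hG⟩
  have h := congrArg (fun F => F v) (hskew (Equiv.swap i j))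
  simp only [MultilinearMap.domDomCongr_apply, smul_apply, Equiv.Perm.sign_swap hij] at h
  have hv' : (fun l => v (Equiv.swap i j l)) = v := funext fun l => by
    by_cases hi : l = i
    · rw [hi, Equiv.swap_apply_left, hv]
    · by_cases hj : l = j
      · rw [hj, Equiv.swap_apply_right, hv]
      · rw [Equiv.swap_apply_of_ne_of_ne hi hj]
  rw [hv'] at h
  refine eq_zero_of_add_self (R := R) (eq_neg_iff_add_eq_zero.1 ?_)
  simpa using h

theorem exists_extends {n : ℕ} {f : RawCochain L M n} (hf : f ∈ cochains L M n) :
    ∃ F : Form (Cur R L) (Cur R M) n, IsAlt R F ∧ Extends F f := by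
  cases n with
  | zero =>
    refine ⟨fun _ => evCoch Fin.elim0 (f Fin.elim0), .of_zero _, fun s p => ?_⟩
    rw [Subsingleton.elim s Fin.elim0, Subsingleton.elim p Fin.elim0]
  | succ k => exact exists_extends_of_isCochain hf

theorem Extends.apply_lam {k : ℕ} {F : Form (Cur (LamRing k) L) (Cur (LamRing k) M) (k + 1)}
    {f : (Fin (k + 1) → L) → LamPoly k M} (h : Extends (n := k + 1) F f) (p : Fin (k + 1) → L) :
    ev (AlgHom.id ℂ (LamRing k)) (f p) = F fun i => cur (lam k i) (p i) := by
  rw [h.succ, lamHom_lam_eq_id]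

/-- At the generic point `sᵢ = λᵢ` the form determines `f`, so each cochain axiom is the matching
property of an alternating form, read off through the injective evaluation. -/
theorem Extends.isCochain {k : ℕ} {F : Form (Cur (LamRing k) L) (Cur (LamRing k) M) (k + 1)}
    {f : (Fin (k + 1) → L) → LamPoly k M} (h : Extends (n := k + 1) F f)
    (hF : IsAlt (LamRing k) F) : IsCochain f := by
  obtain ⟨F, rfl⟩ := hF
  have hu : ∀ (p : Fin (k + 1) → L) i x,
      (fun j => cur (lam k j) (Function.update p i x j)) =
        Function.update (fun j => cur (lam k j) (p j)) i (cur (lam k i) x) := fun p i x => by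
    funext j
    by_cases hj : j = i
    · subst hj; simp
    · simp [hj]
  refine ⟨fun p i x y => ?_, fun p i c x => ?_, fun p i => ?_, fun τ p => ?_⟩ <;>
    apply ev_id_injective
  · rw [map_add, h.apply_lam, h.apply_lam, h.apply_lam, hu, hu, hu, map_add, F.map_update_add]
  · have hc : cur (lam k i) (c • x) = algebraMap ℂ (LamRing k) c • cur (lam k i) x := by
      rw [← algebraMap_smul DRing c x, cur_smul]
      simp
    rw [ev_csmul, h.apply_lam, h.apply_lam, hu, hu, hc, F.map_update_smul]
  · rw [map_neg, ev_smul, h.apply_lam, h.apply_lam, hu, cur_smul, Polynomial.aeval_X,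
      F.map_update_smul, neg_smul, Function.update_eq_self]
    rfl
  · rw [ev_evalAt f (μ := lam k ∘ τ) (s := lam k ∘ τ) (fun _ => rfl)
      (by
        have : ∑ i, (lam k ∘ τ) i = ∑ i, lam k i := Equiv.sum_comp τ (lam k)
        rw [this, sum_lam, neg_neg]; rfl), ← h.succ, map_zsmul, h.apply_lam]
    exact F.map_perm (fun i => cur (lam k i) (p i)) τ

theorem Extends.eq {n : ℕ} {F G : Form (Cur (LamRing n) L) (Cur (LamRing n) M) (n + 1)}
    {f g : RawCochain L M (n + 1)} (hf : Extends F f) (hg : Extends G g) (h : F = G) :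
    f = g := by
  subst h
  funext p
  exact ev_id_injective ((hf.apply_lam p).trans (hg.apply_lam p).symm)

namespace Extends

variable {n : ℕ} {F G : Form (Cur R L) (Cur R M) n} {f g : RawCochain L M n}

theorem add (hF : Extends F f) (hG : Extends G g) : Extends (F + G) (f + g) := fun s p => by
  rw [Pi.add_apply, Pi.add_apply, map_add, hF, hG]

theorem zsmul (hF : Extends F f) (c : ℤ) : Extends (c • F) (c • f) := fun s p => by
  rw [Pi.smul_apply, Pi.smul_apply, map_zsmul, hF]

theorem zero : Extends (0 : Form (Cur R L) (Cur R M) n) (0 : RawCochain L M n) := fun s p => by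
  rw [Pi.zero_apply, Pi.zero_apply, map_zero]

theorem csmul (hF : Extends F f) (c : ℂ) : Extends (algebraMap ℂ R c • F) (c • f) :=
  fun s p => by rw [Pi.smul_apply, Pi.smul_apply, evCoch_csmul, hF]

end Extends

end Extension

/-! ### The conformal operators extend to the classical ones -/

section Comparison

variable {R : Type*} [CommRing R] [Algebra ℂ R]
variable {L : Type u} [AddCommGroup L] [Module ℂ L] [Module DRing L] [IsScalarTower ℂ DRing L]
variable {M : Type v} [AddCommGroup M] [Module ℂ M] [Module DRing M] [IsScalarTower ℂ DRing M]

theorem ev_ceSum_bracket {b : L → L → LamPoly 1 L}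
    {bh : Cur R L →ₗ[R] Cur R L →ₗ[R] Cur R L} (hb : Induces b bh) {k : ℕ}
    {F : Cur R L [⋀^Fin (k + 1)]→ₗ[R] Cur R M} {f : (Fin (k + 1) → L) → LamPoly k M}
    (hF : Extends (n := k + 1) F f) (s : Fin (k + 2) → R) (p : Fin (k + 2) → L)
    {i : Fin (k + 1)} {j : Fin (k + 2)} (hij : i.castSucc < j) :
    ev (lamHom (fun i => s i.castSucc) (∑ i, s i))
        (evalWith ![lam (k + 1) i.castSucc]
          (fun c => evalAt f
            (Fin.cons (lam (k + 1) i.castSucc + lam (k + 1) j)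
              fun a => lam (k + 1) (j.succAbove (i.succAbove a)))
            (Fin.cons c fun a => p (j.succAbove (i.succAbove a))))
          (b (p i.castSucc) (p j))) =
      F (Fin.cons (bh (cur (s i.castSucc) (p i.castSucc)) (cur (s j) (p j)))
        fun a => cur (s (j.succAbove (i.succAbove a))) (p (j.succAbove (i.succAbove a)))) := by
  have hi : j.succAbove i = i.castSucc := Fin.succAbove_of_castSucc_lt _ _ hij
  let w : Fin k → Cur R L :=
    fun a => cur (s (j.succAbove (i.succAbove a))) (p (j.succAbove (i.succAbove a)))
  -- `F` with all arguments but the first frozen; the `0` in `Fin.cons 0 w` is overwritten.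
  let Φ : Cur R L →ₗ[R] Cur R M := F.toMultilinearMap.toLinearMap (Fin.cons 0 w) 0
  have hΦ : ∀ x, Φ x = F (Fin.cons x w) := fun x =>
    congrArg F (Fin.update_cons_zero (α := fun _ => Cur R L) 0 w x)
  rw [hb, ← hΦ]
  refine ev_evalWith _ (fun a => ?_) Φ (fun c => ?_) _
  · fin_cases a
    simp only [Fin.zero_eta, Matrix.cons_val_zero, lamHom_lv]
    exact lamHom_lam s _
  -- The bracket carries the parameter `sᵢ + sⱼ`, so the total index is unchanged.
  · let s' : Fin (k + 1) → R := Fin.cons (s i.castSucc + s j)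
      fun a => s (j.succAbove (i.succAbove a))
    have hs' : ∑ a, s' a = ∑ a, s a := by
      rw [Fin.sum_univ_succ, Fin.sum_univ_succAbove s j,
        Fin.sum_univ_succAbove (fun a => s (j.succAbove a)) i, hi]
      simp only [s', Fin.cons_zero, Fin.cons_succ]
      ring
    rw [ev_evalAt f (s := s') (Fin.cases ?_ fun a => ?_) (by rw [lamHom_del, hs']), ← hF.succ, hΦ,
      lamHom_del, neg_neg]
    · congr 1
      exact funext (Fin.cases rfl fun _ => rfl)
    · simp only [Fin.cons_zero, map_add, lamHom_lam, s']
    · simp only [Fin.cons_succ, lamHom_lam, s']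

theorem Extends.ceSum {b : L → L → LamPoly 1 L} {B : L → M → LamPoly 1 M}
    {bh : Cur R L →ₗ[R] Cur R L →ₗ[R] Cur R L} {Bh : Cur R L →ₗ[R] Cur R M →ₗ[R] Cur R M}
    (hb : Induces b bh) (hB : Induces B Bh) {k : ℕ} {F : Form (Cur R L) (Cur R M) (k + 1)}
    (hA : IsAlt R F) {f : (Fin (k + 1) → L) → LamPoly k M} (hF : Extends (n := k + 1) F f) :
    Extends (n := k + 2) (ce bh Bh F) (ceSum b B f) := by
  obtain ⟨F, rfl⟩ := hA
  intro s p
  change _ = ev (lamHom (fun i => s i.castSucc) (∑ i, s i)) (NijLCA.ceSum b B f p)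
  rw [ce_apply, NijLCA.ceSum, map_add, map_sum, map_sum]
  simp only [smul_add, Finset.sum_add_distrib]
  congr 1
  · refine Finset.sum_congr rfl fun i _ => ?_
    rw [map_zsmul, ev_opAct hB (lamHom (fun a => s (i.succAbove a.castSucc))
      (∑ a, s (i.succAbove a))) _ _ (fun a => by rw [lamHom_lam, lamHom_lv])
      (by rw [lamHom_lam, lamHom_del, lamHom_del, Fin.sum_univ_succAbove s i]; ring),
      lamHom_lam]
    congr 2
    exact hF.succ (fun a => s (i.succAbove a)) (fun a => p (i.succAbove a))
  · refine Finset.sum_congr rfl fun j _ => ?_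
    rw [map_sum, Finset.smul_sum]
    refine Finset.sum_congr rfl fun i _ => ?_
    split_ifs with hij
    -- `ceSum` puts the bracket first with sign `(-1)^(i+j)`, while `ce` leaves it at position `i`
    -- with sign `(-1)^j`; moving it accounts for `(-1)^i`.
    · rw [map_zsmul, ev_ceSum_bracket hb hF s p hij, ← Fin.insertNth_removeNth,
        AlternatingMap.map_insertNth, pow_add, mul_comm, mul_smul]
      rfl
    · rw [map_zero, smul_zero]

variable [LieConformalAlgebra L]

theorem ev_actZero {ρ : ConformalRep L M} {B : Cur R L →ₗ[R] Cur R M →ₗ[R] Cur R M}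
    (hB : Induces (fun p m => ρ.act p m) B) (s : Fin 1 → R) (p : L) (t : Fin 0 → R)
    (c : CochVal M 0) :
    evCoch (n := 1) s (actZero ρ p c) = B (cur (s 0) p) (evCoch t c) := by
  obtain ⟨m, rfl⟩ := (delRange M).mkQ_surjective c
  change ev _ (subst ![-del 0] (ρ.act p m)) = B (cur (s 0) p) (cur 0 m)
  rw [hB]
  refine ev_subst _ (fun i => ?_) ?_ _
  · fin_cases i; simp
  · simp

/-- The map `N` is a parameter so that one statement serves both the plain action (`N = id`) and the
deformed one. The bracket is arbitrary, as there are no pairs of arguments in degree `0`. -/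
theorem Extends.ce_zero {ρ : ConformalRep L M} {B : Cur R L →ₗ[R] Cur R M →ₗ[R] Cur R M}
    (hB : Induces (fun p m => ρ.act p m) B) (b : Cur R L →ₗ[R] Cur R L →ₗ[R] Cur R L)
    (N : L →ₗ[DRing] L) {F : Form (Cur R L) (Cur R M) 0} {f : RawCochain L M 0}
    (hF : Extends F f) :
    Extends (n := 1) (ce b (B ∘ₗ curMap R N) F) fun p => actZero ρ (N (p 0)) (f Fin.elim0) := by
  intro s p
  rw [ev_actZero hB s _ Fin.elim0, ce_apply]
  have := hF Fin.elim0 Fin.elim0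
  rw [← this]
  simp [Subsingleton.elim (Fin.removeNth 0 fun i => cur (s i) (p i)) fun i =>
    cur (Fin.elim0 i : R) (Fin.elim0 i : L)]

theorem Extends.rawDelta {ρ : ConformalRep L M} {b : Cur R L →ₗ[R] Cur R L →ₗ[R] Cur R L}
    {B : Cur R L →ₗ[R] Cur R M →ₗ[R] Cur R M} (hb : Induces (br (L := L)) b)
    (hB : Induces (fun p m => ρ.act p m) B) {n : ℕ} {F : Form (Cur R L) (Cur R M) n}
    (hA : IsAlt R F) {f : RawCochain L M n} (hF : Extends F f) :
    Extends (ce b B F) (rawDelta ρ n f) := by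
  cases n with
  | zero =>
    have h := hF.ce_zero hB b LinearMap.id
    have h1 : curMap R (LinearMap.id : L →ₗ[DRing] L) = LinearMap.id :=
      Cur.hom_ext fun z m => by simp
    rwa [h1] at h
  | succ k => exact Extends.ceSum hb hB hA hF

theorem evCoch_ext {k : ℕ} (s : Fin (k + 1) → R) (T : M →ₗ[DRing] M) (v : LamPoly k M) :
    evCoch (n := k + 1) s (ext k T v) = curMap R T (evCoch (n := k + 1) s v) :=
  ev_ext _ T v

theorem curMap_pow (T : M →ₗ[DRing] M) (n : ℕ) : curMap R (T ^ n) = curMap R T ^ n := by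
  refine Cur.hom_ext fun z m => ?_
  rw [curMap_cur]
  induction n generalizing m with
  | zero => rfl
  | succ n ih => rw [pow_succ, pow_succ, Module.End.mul_apply, Module.End.mul_apply, curMap_cur, ih]

theorem Extends.rawDN {ρ : ConformalRep L M} {b : Cur R L →ₗ[R] Cur R L →ₗ[R] Cur R L}
    {B : Cur R L →ₗ[R] Cur R M →ₗ[R] Cur R M} (hb : Induces (br (L := L)) b)
    (hB : Induces (fun p m => ρ.act p m) B) (N : L →ₗ[DRing] L) (NM : M →ₗ[DRing] M) {n : ℕ}
    {F : Form (Cur R L) (Cur R M) n}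
    (hA : IsAlt R F) {f : RawCochain L M n} (hF : Extends F f) :
    Extends (dNij b B (curMap R N) (curMap R NM) F) (rawDN N ρ NM n f) := by
  have h2 := Extends.rawDelta hb hB hA hF
  cases n with
  | zero =>
    intro s p
    have h1 := hF.ce_zero hB (deformed b (curMap R N)) N
    rw [dNij_apply, Pi.sub_apply, h1, post_apply, h2]
    refine Eq.trans ?_ (map_sub (evCoch (R := R) (M := M) s) _ _).symm
    exact congrArg _ (evCoch_ext s NM _).symm
  | succ k =>
    intro s p
    have h1 := Extends.ceSum (hb.deformed N) (hB.comp N) hA hF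
    rw [dNij_apply, Pi.sub_apply, h1, post_apply, h2]
    refine Eq.trans ?_ (map_sub (evCoch (R := R) (M := M) s) _ _).symm
    exact congrArg _ (evCoch_ext s NM _).symm

theorem Extends.rawXi (N : L →ₗ[DRing] L) (NM : M →ₗ[DRing] M) {n : ℕ}
    {F : Form (Cur R L) (Cur R M) n} {f : RawCochain L M n} (hF : Extends F f) :
    Extends (xi (curMap R N) (curMap R NM) F) (rawXi N NM n f) := by
  cases n with
  | zero => rw [xi_zero]; exact hF
  | succ k =>
    intro s p
    rw [xi_apply]
    refine Eq.trans ?_ (map_sum (evCoch (R := R) (M := M) s) _ _).symm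
    refine Finset.sum_congr rfl fun S _ => ?_
    refine Eq.trans ?_ (map_zsmul (evCoch (R := R) (M := M) s) _ _).symm
    congr 1
    refine Eq.trans ?_ (evCoch_ext s (NM ^ S.card) _).symm
    rw [curMap_pow, ← hF s]
    congr 2
    funext i
    split_ifs <;> simp

end Comparison

/-! ### The mapping cone complex -/

section Complex

variable {L : Type u} [AddCommGroup L] [Module ℂ L] [Module DRing L] [IsScalarTower ℂ DRing L]
variable {M : Type v} [AddCommGroup M] [Module ℂ M] [Module DRing M] [IsScalarTower ℂ DRing M]

/-- `T` maps `m`-cochains to `n`-cochains, and is `ℂ`-linear on them. -/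
structure IsCochainMap {m n : ℕ} (T : RawCochain L M m → RawCochain L M n) : Prop where
  mem : ∀ f ∈ cochains L M m, T f ∈ cochains L M n
  add : ∀ f ∈ cochains L M m, ∀ g ∈ cochains L M m, T (f + g) = T f + T g
  smul : ∀ (c : ℂ), ∀ f ∈ cochains L M m, T (c • f) = c • T f

/-- Over `LamRing n` a map into degree `n + 1` is determined by its extension. Only cochains are
known to extend, which is why linearity is claimed on cochains alone. -/
theorem IsCochainMap.of_extends {m n : ℕ} {T : RawCochain L M m → RawCochain L M (n + 1)}
    (Th : Form (Cur (LamRing n) L) (Cur (LamRing n) M) m →ₗ[LamRing n]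
      Form (Cur (LamRing n) L) (Cur (LamRing n) M) (n + 1))
    (hT : ∀ F f, IsAlt (LamRing n) F → Extends F f → Extends (Th F) (T f))
    (hA : ∀ F, IsAlt (LamRing n) F → IsAlt (LamRing n) (Th F)) : IsCochainMap T := by
  refine ⟨fun f hf => ?_, fun f hf g hg => ?_, fun c f hf => ?_⟩
  · obtain ⟨F, hF, h⟩ := exists_extends (R := LamRing n) hf
    exact (hT F f hF h).isCochain (hA F hF)
  · obtain ⟨F, hF, h⟩ := exists_extends (R := LamRing n) hf
    obtain ⟨G, hG, h'⟩ := exists_extends (R := LamRing n) hg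
    exact (hT _ _ (hF.add hG) (h.add h')).eq ((hT F f hF h).add (hT G g hG h')) (map_add Th F G)
  · obtain ⟨F, hF, h⟩ := exists_extends (R := LamRing n) hf
    exact (hT _ _ (hF.smul _) (h.csmul c)).eq ((hT F f hF h).csmul c) (map_smul Th _ F)

variable [LieConformalAlgebra L] {N : L →ₗ[DRing] L} {ρ : ConformalRep L M} {NM : M →ₗ[DRing] M}

theorem exists_isNijenhuisPair (R : Type*) [CommRing R] [Algebra ℂ R] (hN : IsNijenhuis N)
    (hρ : IsNijenhuisRep N ρ NM) :
    ∃ (b : Cur R L →ₗ[R] Cur R L →ₗ[R] Cur R L) (B : Cur R L →ₗ[R] Cur R M →ₗ[R] Cur R M),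
      Induces (br (L := L)) b ∧ Induces (fun p m => ρ.act p m) B ∧
        IsNijenhuisPair b B (curMap R N) (curMap R NM) := by
  obtain ⟨b, hb⟩ := exists_induces (R := R) (LieConformalAlgebra.bracket (L := L))
    LieConformalAlgebra.del_left LieConformalAlgebra.del_right
  obtain ⟨B, hB⟩ := exists_induces (R := R) ρ.act ρ.del_left ρ.del_right
  exact ⟨b, B, hb, hB, Induces.isLieRep hb hB, Induces.nijenhuis hb hN, Induces.nijenhuis hB hρ⟩

theorem isCochainMap_rawDelta (hN : IsNijenhuis N) (hρ : IsNijenhuisRep N ρ NM) (n : ℕ) :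
    IsCochainMap (rawDelta ρ n) := by
  obtain ⟨b, B, hb, hB, h⟩ := exists_isNijenhuisPair (LamRing n) hN hρ
  exact .of_extends (ce b B) (fun F f hF hf => Extends.rawDelta hb hB hF hf)
    fun F hF => hF.isAlt_ce h.self

theorem isCochainMap_rawDN (hN : IsNijenhuis N) (hρ : IsNijenhuisRep N ρ NM) (n : ℕ) :
    IsCochainMap (rawDN N ρ NM n) := by
  obtain ⟨b, B, hb, hB, h⟩ := exists_isNijenhuisPair (LamRing n) hN hρ
  exact .of_extends (dNij b B _ _) (fun F f hF hf => Extends.rawDN hb hB N NM hF hf)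
    fun F hF => h.isAlt_dNij hF

theorem isCochainMap_rawXi (N : L →ₗ[DRing] L) (NM : M →ₗ[DRing] M) (n : ℕ) :
    IsCochainMap (rawXi N NM n) := by
  cases n with
  | zero => exact ⟨fun _ h => h, fun _ _ _ _ => rfl, fun _ _ _ => rfl⟩
  | succ k =>
    exact .of_extends (xi (curMap (LamRing k) N) (curMap (LamRing k) NM))
      (fun F f _ hf => hf.rawXi N NM) fun F hF => hF.isAlt_xi _ _

theorem rawDelta_rawDelta (hN : IsNijenhuis N) (hρ : IsNijenhuisRep N ρ NM) {n : ℕ}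
    {f : RawCochain L M n} (hf : f ∈ cochains L M n) :
    rawDelta ρ (n + 1) (rawDelta ρ n f) = 0 := by
  obtain ⟨b, B, hb, hB, h⟩ := exists_isNijenhuisPair (LamRing (n + 1)) hN hρ
  obtain ⟨F, hF, hFf⟩ := exists_extends (R := LamRing (n + 1)) hf
  exact (Extends.rawDelta hb hB (hF.isAlt_ce h.self) (Extends.rawDelta hb hB hF hFf)).eq .zero
    (h.ce_ce hF)

/-- The mixed component of the squared cone differential; the alternating sign turns the commutation
of `ξ` with the differentials into cancellation. -/
theorem rawXi_rawDelta_add_rawDN (hN : IsNijenhuis N) (hρ : IsNijenhuisRep N ρ NM) {n : ℕ}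
    {f : RawCochain L M n} (hf : f ∈ cochains L M n) :
    (-1 : ℤ) ^ (n + 1) • rawXi N NM (n + 1) (rawDelta ρ n f) +
      rawDN N ρ NM n ((-1 : ℤ) ^ n • rawXi N NM n f) = 0 := by
  obtain ⟨b, B, hb, hB, h⟩ := exists_isNijenhuisPair (LamRing n) hN hρ
  obtain ⟨F, hF, hFf⟩ := exists_extends (R := LamRing n) hf
  refine ((((Extends.rawDelta hb hB hF hFf).rawXi N NM).zsmul _).add
    (Extends.rawDN hb hB N NM ((hF.isAlt_xi _ _).zsmul _) ((hFf.rawXi N NM).zsmul _))).eq .zero ?_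
  rw [h.xi_ce hF, map_zsmul, pow_succ, mul_neg_one, neg_smul, neg_add_cancel]

theorem rawDN_rawDN (hN : IsNijenhuis N) (hρ : IsNijenhuisRep N ρ NM) {n : ℕ}
    {f : RawCochain L M n} (hf : f ∈ cochains L M n) :
    rawDN N ρ NM (n + 1) (rawDN N ρ NM n f) = 0 := by
  obtain ⟨b, B, hb, hB, h⟩ := exists_isNijenhuisPair (LamRing (n + 1)) hN hρ
  obtain ⟨F, hF, hFf⟩ := exists_extends (R := LamRing (n + 1)) hf
  exact (Extends.rawDN hb hB N NM (h.isAlt_dNij hF) (Extends.rawDN hb hB N NM hF hFf)).eq .zero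
    (h.dNij_dNij hF)

theorem zsmul_mem_cochains {n : ℕ} {f : RawCochain L M n} (hf : f ∈ cochains L M n) (c : ℤ) :
    c • f ∈ cochains L M n :=
  zsmul_mem hf c

theorem fst_mem_cochains {n : ℕ} {x : RawCochain L M n × RawCochain L M (n - 1)}
    (hx : x ∈ nlCochainsFull L M n) : x.1 ∈ cochains L M n := by
  cases n with
  | zero => trivial
  | succ n => exact (Submodule.mem_prod.1 hx).1

theorem snd_mem_cochains {n : ℕ} {x : RawCochain L M (n + 1) × RawCochain L M n}
    (hx : x ∈ nlCochainsFull L M (n + 1)) : x.2 ∈ cochains L M n :=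
  (Submodule.mem_prod.1 hx).2

theorem rawDNL_mem (hN : IsNijenhuis N) (hρ : IsNijenhuisRep N ρ NM) (n : ℕ) :
    ∀ x ∈ nlCochainsFull L M n, rawDNL N ρ NM n x ∈ nlCochainsFull L M (n + 1) := by
  rintro ⟨f, g⟩ hx
  have hf := fst_mem_cochains hx
  cases n with
  | zero => exact ⟨(isCochainMap_rawDelta hN hρ 0).mem f hf, hf⟩
  | succ n =>
    have hg := snd_mem_cochains hx
    exact ⟨(isCochainMap_rawDelta hN hρ (n + 1)).mem f hf,
      Submodule.add_mem _ (zsmul_mem_cochains ((isCochainMap_rawXi N NM (n + 1)).mem f hf) _)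
        ((isCochainMap_rawDN hN hρ n).mem g hg)⟩

theorem rawDNL_add (hN : IsNijenhuis N) (hρ : IsNijenhuisRep N ρ NM) (n : ℕ) :
    ∀ x ∈ nlCochainsFull L M n, ∀ y ∈ nlCochainsFull L M n,
      rawDNL N ρ NM n (x + y) = rawDNL N ρ NM n x + rawDNL N ρ NM n y := by
  rintro ⟨f, g⟩ hx ⟨f', g'⟩ hy
  have hf := fst_mem_cochains hx
  have hf' := fst_mem_cochains hy
  have h1 := (isCochainMap_rawDelta hN hρ n).add f hf f' hf'
  cases n with
  | zero => exact Prod.ext h1 rfl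
  | succ n =>
    have hg := snd_mem_cochains hx
    have hg' := snd_mem_cochains hy
    refine Prod.ext h1 ?_
    change (-1 : ℤ) ^ (n + 1) • rawXi N NM (n + 1) (f + f') + rawDN N ρ NM n (g + g') =
      ((-1 : ℤ) ^ (n + 1) • rawXi N NM (n + 1) f + rawDN N ρ NM n g) +
        ((-1 : ℤ) ^ (n + 1) • rawXi N NM (n + 1) f' + rawDN N ρ NM n g')
    rw [(isCochainMap_rawXi N NM (n + 1)).add f hf f' hf',
      (isCochainMap_rawDN hN hρ n).add g hg g' hg', smul_add, add_add_add_comm]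

theorem rawDNL_smul (hN : IsNijenhuis N) (hρ : IsNijenhuisRep N ρ NM) (n : ℕ) (c : ℂ) :
    ∀ x ∈ nlCochainsFull L M n, rawDNL N ρ NM n (c • x) = c • rawDNL N ρ NM n x := by
  rintro ⟨f, g⟩ hx
  have hf := fst_mem_cochains hx
  have h1 := (isCochainMap_rawDelta hN hρ n).smul c f hf
  cases n with
  | zero => exact Prod.ext h1 rfl
  | succ n =>
    have hg := snd_mem_cochains hx
    refine Prod.ext h1 ?_
    change (-1 : ℤ) ^ (n + 1) • rawXi N NM (n + 1) (c • f) + rawDN N ρ NM n (c • g) =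
      c • ((-1 : ℤ) ^ (n + 1) • rawXi N NM (n + 1) f + rawDN N ρ NM n g)
    rw [(isCochainMap_rawXi N NM (n + 1)).smul c f hf, (isCochainMap_rawDN hN hρ n).smul c g hg,
      smul_add, smul_comm c]

theorem rawDNL_rawDNL (hN : IsNijenhuis N) (hρ : IsNijenhuisRep N ρ NM) (n : ℕ) :
    ∀ x ∈ nlCochainsFull L M n, rawDNL N ρ NM (n + 1) (rawDNL N ρ NM n x) = 0 := by
  rintro ⟨f, g⟩ hx
  have hf := fst_mem_cochains hx
  have h1 := rawDelta_rawDelta hN hρ hf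
  have h2 := rawXi_rawDelta_add_rawDN hN hρ hf
  cases n with
  | zero =>
    refine Prod.ext h1 ?_
    rwa [pow_zero, one_smul] at h2
  | succ n =>
    have hg := snd_mem_cochains hx
    refine Prod.ext h1 ?_
    change (-1 : ℤ) ^ (n + 2) • rawXi N NM (n + 2) (rawDelta ρ (n + 1) f) +
      rawDN N ρ NM (n + 1) ((-1 : ℤ) ^ (n + 1) • rawXi N NM (n + 1) f + rawDN N ρ NM n g) = 0
    rw [(isCochainMap_rawDN hN hρ (n + 1)).add _
        (zsmul_mem_cochains ((isCochainMap_rawXi N NM (n + 1)).mem f hf) _) _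
        ((isCochainMap_rawDN hN hρ n).mem g hg), ← add_assoc, h2, rawDN_rawDN hN hρ hg, add_zero]

theorem formsCochainComplex_of {A : ℕ → Type v} [∀ n, AddCommGroup (A n)] [∀ n, Module ℂ (A n)]
    {G : ∀ n, Submodule ℂ (A n)} {D : ∀ n, A n → A (n + 1)}
    (hmem : ∀ n, ∀ x ∈ G n, D n x ∈ G (n + 1))
    (hadd : ∀ n, ∀ x ∈ G n, ∀ y ∈ G n, D n (x + y) = D n x + D n y)
    (hsmul : ∀ n (c : ℂ), ∀ x ∈ G n, D n (c • x) = c • D n x)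
    (hsq : ∀ n, ∀ x ∈ G n, D (n + 1) (D n x) = 0) : FormsCochainComplex G D :=
  ⟨fun n =>
    { toFun := fun x => ⟨D n x, hmem n x x.2⟩
      map_add' := fun x y => Subtype.ext (hadd n x x.2 y y.2)
      map_smul' := fun c x => Subtype.ext (hsmul n c x x.2) },
    fun _ _ => rfl, fun n => LinearMap.ext fun x => Subtype.ext (hsq n x x.2)⟩

theorem formsCochainComplex_full (hN : IsNijenhuis N) (hρ : IsNijenhuisRep N ρ NM) :
    FormsCochainComplex (nlCochainsFull L M) (rawDNL N ρ NM) :=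
  formsCochainComplex_of (rawDNL_mem hN hρ) (rawDNL_add hN hρ) (rawDNL_smul hN hρ)
    (rawDNL_rawDNL hN hρ)

theorem nlCochains_le (n : ℕ) : nlCochains L M n ≤ nlCochainsFull L M (n + 1) := by
  cases n with
  | zero => exact Submodule.prod_mono le_rfl bot_le
  | succ n => exact le_rfl

/-- This is the full complex in degrees at least 1, with the summand `C⁰` in degree 1 replaced by
zero. That is a subcomplex because nothing maps into degree 1, so every property is inherited. -/
theorem formsCochainComplex_nl (hN : IsNijenhuis N) (hρ : IsNijenhuisRep N ρ NM) :
    FormsCochainComplex (nlCochains L M) fun n => rawDNL N ρ NM (n + 1) :=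
  formsCochainComplex_of (fun n x hx => rawDNL_mem hN hρ (n + 1) x (nlCochains_le n hx))
    (fun n x hx y hy => rawDNL_add hN hρ (n + 1) x (nlCochains_le n hx) y (nlCochains_le n hy))
    (fun n c x hx => rawDNL_smul hN hρ (n + 1) c x (nlCochains_le n hx))
    fun n x hx => rawDNL_rawDNL hN hρ (n + 1) x (nlCochains_le n hx)

end Complex

end NijLCA

theorem mainTheorem8 {L : Type*} [AddCommGroup L] [Module ℂ L] [Module NijLCA.DRing L]
    [IsScalarTower ℂ NijLCA.DRing L] [NijLCA.LieConformalAlgebra L]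
    (N : L →ₗ[NijLCA.DRing] L) (hN : NijLCA.IsNijenhuis N) :
    (NijLCA.FormsCochainComplex (NijLCA.nlCochains L L)
        (fun n => NijLCA.rawDNL N (NijLCA.adjoint L) N (n + 1)) ∧
      NijLCA.FormsCochainComplex (NijLCA.nlCochainsFull L L)
        (NijLCA.rawDNL N (NijLCA.adjoint L) N)) ∧
    ∀ {M : Type*} [AddCommGroup M] [Module ℂ M] [Module NijLCA.DRing M]
      [IsScalarTower ℂ NijLCA.DRing M] (ρ : NijLCA.ConformalRep L M)
      (NM : M →ₗ[NijLCA.DRing] M), NijLCA.IsNijenhuisRep N ρ NM →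
      NijLCA.FormsCochainComplex (NijLCA.nlCochains L M)
          (fun n => NijLCA.rawDNL N ρ NM (n + 1)) ∧
        NijLCA.FormsCochainComplex (NijLCA.nlCochainsFull L M) (NijLCA.rawDNL N ρ NM) := by
  -- For the adjoint action the two Nijenhuis conditions agree by definition.
  have hρ : NijLCA.IsNijenhuisRep N (NijLCA.adjoint L) N := hN
  exact ⟨⟨NijLCA.formsCochainComplex_nl hN hρ, NijLCA.formsCochainComplex_full hN hρ⟩,
    fun ρ NM h => ⟨NijLCA.formsCochainComplex_nl hN h, NijLCA.formsCochainComplex_full hN h⟩⟩
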